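/- Let $M\subset\mathbb R^{2n}$ be an open set containing the origin, with points $z=(q,p)$ and Euclidean norm $\|\cdot\|$. Put $I_j(q,p)=\frac{p_j^2+q_j^2}{2}$ and let $H=H_0+P$ on $M$, where $H_0=\sum_{j=1}^n\omega_jI_j$ with $\omega\in\mathbb R^n$, and $P\in C^\infty(M,\mathbb R)$ satisfies $P(z)=O(\|z\|^3)$ as $z\to0$. Assume that $\omega$ is non-resonant, i.e. $\sum_{j}k_j\omega_j\neq0$ for all $k\in\mathbb Z^n\setminus\{0\}$. Then for every integer $r\ge3$ there exist $\varepsilon_0>0$, $C>0$ and a real analytic canonical transformation (a diffeomorphism with real analytic inverse that preserves the Poisson bracket) $\tau:\mathcal U\to\mathcal V$ between open neighbourhoods $\mathcal U,\mathcal V\subset M$ of the origin, with $\tau(z')=z'+O(\|z'\|^2)$, which puts $H$ in Birkhoff normal form up to order $r$, that is $$H\circ\tau=H_0+Z+R,$$ where $Z$ is a polynomial of degree at most $r$ in $z'$ that depends only on the actions $I_1(z'),\dots,I_n(z')$, and $R(z')=O(\|z'\|^{r+1})$; and these can be chosen such that the following holds for every $z_0=(q_0,p_0)$ with $\|z_0\|=\varepsilon<\varepsilon_0$.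 The point $z_0$ lies in $\mathcal V$, the torus $\{z'\in\mathbb R^{2n}: I_j(z')=I_j(\tau^{-1}(z_0)),\ j=1,\dots,n\}$ (a product of $n$ circles, some of which may be reduced to points) is contained in $\mathcal U$, and its image $$\mathcal T_0=\{z\in\mathcal V:\ I_j(\tau^{-1}(z))=I_j(\tau^{-1}(z_0)),\ j=1,\dots,n\}\subset M$$ satisfies, for all real $r_1\ge0$ and $r_2$ with $r_1+r_2=r+1$: the solution $(q(t),p(t))$ of the Hamiltonian system $\dot q_j=\partial H/\partial p_j$, $\dot p_j=-\partial H/\partial q_j$ with $(q(0),p(0))=(q_0,p_0)$ exists in $M$ for $|t|\le 1/\varepsilon^{r_2}$, and $$\operatorname{dist}\big((q(t),p(t)),\mathcal T_0\big)\le C\,\varepsilon^{r_1}\qquad\text{for } |t|\le \frac1{\varepsilon^{r_2}}.$$ -/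

import Mathlib

open scoped Topology

noncomputable section

namespace Birkhoff

/-- The space `ℝ²ⁿ` with its Euclidean norm; `z (Sum.inl j)` is the position `q_j` and
`z (Sum.inr j)` is the momentum `p_j` of the point `z = (q, p)`. -/
abbrev Phase (n : ℕ) : Type := EuclideanSpace ℝ (Fin n ⊕ Fin n)

variable {n : ℕ}

/-- The partial derivative `∂F/∂q_j` at `z`. -/
def dq (F : Phase n → ℝ) (j : Fin n) (z : Phase n) : ℝ :=
  fderiv ℝ F z (EuclideanSpace.single (Sum.inl j) 1)

/-- The partial derivative `∂F/∂p_j` at `z`. -/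
def dp (F : Phase n → ℝ) (j : Fin n) (z : Phase n) : ℝ :=
  fderiv ℝ F z (EuclideanSpace.single (Sum.inr j) 1)

/-- The Hamiltonian vector field `X_H = (∂H/∂p, -∂H/∂q)`. -/
def hamVectorField (H : Phase n → ℝ) (z : Phase n) : Phase n :=
  WithLp.toLp 2 (Sum.elim (fun j => dp H j z) (fun j => -dq H j z))

/-- The Poisson bracket `{F, G}`. -/
def poissonBracket (F G : Phase n → ℝ) (z : Phase n) : ℝ :=
  ∑ j, (dq F j z * dp G j z - dp F j z * dq G j z)

/-- The `j`-th action `I_j = (p_j² + q_j²) / 2`. -/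
def action (j : Fin n) (z : Phase n) : ℝ :=
  (z (Sum.inr j) ^ 2 + z (Sum.inl j) ^ 2) / 2

/-- The harmonic oscillator `H₀ = ∑ ω_j I_j`. -/
def harmonic (ω : Fin n → ℝ) (z : Phase n) : ℝ :=
  ∑ j, ω j * action j z

/-- The torus `T_a`: the points of `ℝ²ⁿ` with actions `a`, a product of `n` circles
(a circle of radius `0` being a point). -/
def actionTorus (a : Fin n → ℝ) : Set (Phase n) :=
  {z | ∀ j, action j z = a j}

/-- A frequency vector is non resonant if it has no non-trivial integer relation. -/
def NonResonant (ω : Fin n → ℝ) : Prop :=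
  ∀ k : Fin n → ℤ, k ≠ 0 → ∑ j, (k j : ℝ) * ω j ≠ 0

/-- `z` solves the Hamiltonian system of `H` on the set of times `J`, inside the phase space
`M`. -/
def IsSolutionOn (M : Set (Phase n)) (H : Phase n → ℝ) (J : Set ℝ) (z : ℝ → Phase n) : Prop :=
  ∀ t ∈ J, z t ∈ M ∧ HasDerivWithinAt z (hamVectorField H (z t)) J t

/-- A real analytic canonical transformation from the open set `τ.source` onto the open set
`τ.target`. -/
structure IsAnalyticCanonical (τ : OpenPartialHomeomorph (Phase n) (Phase n)) : Prop where
  analytic : AnalyticOnNhd ℝ τ τ.source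
  analytic_symm : AnalyticOnNhd ℝ τ.symm τ.target
  bracket : ∀ F G : Phase n → ℝ, ContDiffOn ℝ (⊤ : ℕ∞) F τ.target → ContDiffOn ℝ (⊤ : ℕ∞) G τ.target →
    ∀ z ∈ τ.source, poissonBracket (F ∘ τ) (G ∘ τ) z = poissonBracket F G (τ z)

/-- `τ` is a real analytic canonical transformation between neighbourhoods of the origin in `M`,
close to the identity, which puts `H = H₀ + P` into non-resonant Birkhoff normal form up to
order `r`: `H ∘ τ = H₀ + Z + R`, with `Z` a polynomial of degree at most `r` in `(q, p)` that
depends on the actions only, and `R = O(‖z‖ ^ (r + 1))`. -/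
structure IsNormalizing (M : Set (Phase n)) (ω : Fin n → ℝ) (P : Phase n → ℝ) (r : ℕ)
    (τ : OpenPartialHomeomorph (Phase n) (Phase n)) : Prop where
  zero_mem_source : 0 ∈ τ.source
  zero_mem_target : 0 ∈ τ.target
  source_subset : τ.source ⊆ M
  target_subset : τ.target ⊆ M
  canonical : IsAnalyticCanonical τ
  near_id : (fun z => τ z - z) =O[𝓝 0] fun z => ‖z‖ ^ 2
  normal_form : ∃ Z : MvPolynomial (Fin n) ℝ, 2 * Z.totalDegree ≤ r ∧
    (fun z => (harmonic ω + P) (τ z)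
        - (harmonic ω z + MvPolynomial.eval (fun j => action j z) Z))
      =O[𝓝 0] fun z => ‖z‖ ^ (r + 1)

/-- The torus through `z₀` on which the normalized actions `I_j ∘ τ⁻¹` are those of `z₀`. -/
def normalizedTorus (τ : OpenPartialHomeomorph (Phase n) (Phase n)) (z₀ : Phase n) :
    Set (Phase n) :=
  {z | z ∈ τ.target ∧ ∀ j, action j (τ.symm z) = action j (τ.symm z₀)}

end Birkhoff

end

/-!
A linear form `ℓ` is constant along the Hamiltonian flow of `c ℓᵐ`, so the time-one map of this
flow is an explicit polynomial symplectic shear defined on all of `ℝ²ⁿ`. Powers of linear forms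
span the homogeneous polynomials, so compositions of shears realize every homogeneous generating
function to leading order, and no flow has to be integrated to remove a homogeneous term. The
homological equation `{G, H₀} = f - Z` is diagonal in the monomials of `q_j ± i p_j`, with
eigenvalues that are integer combinations of the frequencies up to a factor `i`, non-zero except on
the monomials that are polynomials in the actions.

Normalizing up to order `r + 3` instead of `r` leaves a remainder `O(‖z‖ ^ (r + 4))`. In the
normalized coordinates only this remainder moves the radii `√(2 I_j)`, at a rate `O(ε ^ (r + 3))`
as long as the orbit stays at distance `O(ε)` of the origin. A continuity argument confines it there
for the times considered, during which the radii, and so the distance to the torus, change by at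
most `C ε ^ (r + 3) |t| ≤ C ε ^ r₁`.
-/

namespace Birkhoff

open Asymptotics Filter

section HomogeneousFunctions

variable {E F : Type*} [NormedAddCommGroup E] [NormedAddCommGroup F]

theorem isBigO_norm_pow_of_le {m k : ℕ} (h : m ≤ k) :
    (fun z : E => ‖z‖ ^ k) =O[𝓝 0] fun z => ‖z‖ ^ m := by
  refine IsBigO.of_bound 1 ?_
  filter_upwards [Metric.ball_mem_nhds (0 : E) one_pos] with z hz
  rw [mem_ball_zero_iff] at hz
  simpa using pow_le_pow_of_le_one (norm_nonneg z) hz.le h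

variable [NormedSpace ℝ E] [NormedSpace ℝ F]

theorem tendsto_smul_punctured_prod_nhds (x : E) :
    Tendsto (fun p : ℝ × E => p.1 • p.2) (𝓝[≠] 0 ×ˢ 𝓝 x) (𝓝 0) := by
  have hcont : Continuous fun p : ℝ × E => p.1 • p.2 := by fun_prop
  refine (hcont.tendsto' (0, x) 0 (zero_smul ℝ x)).mono_left ?_
  rw [nhds_prod_eq]
  exact prod_mono_left _ nhdsWithin_le_nhds

theorem tendsto_inv_pow_smul_comp_smul {g : E → F} {k : ℕ}
    (hg : g =O[𝓝 0] fun z => ‖z‖ ^ (k + 1)) (x : E) :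
    Tendsto (fun p : ℝ × E => (p.1 ^ k)⁻¹ • g (p.1 • p.2)) (𝓝[≠] 0 ×ˢ 𝓝 x) (𝓝 0) := by
  have hbound : (fun p : ℝ × E => (p.1 ^ k)⁻¹ • g (p.1 • p.2)) =O[𝓝[≠] 0 ×ˢ 𝓝 x]
      fun p => ‖p.1 • p.2‖ * ‖p.2‖ ^ k := by
    refine ((isBigO_refl (fun p : ℝ × E => (p.1 ^ k)⁻¹) _).smul
      (hg.comp_tendsto (tendsto_smul_punctured_prod_nhds x))).trans (IsBigO.of_bound 1 ?_)
    filter_upwards [tendsto_fst.eventually (self_mem_nhdsWithin (a := (0 : ℝ)))] with p hp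
    have hpk : ‖p.1‖ ^ k ≠ 0 := pow_ne_zero k (norm_ne_zero_iff.2 hp)
    simp only [Function.comp_apply, smul_eq_mul, norm_smul, norm_mul, norm_inv, norm_pow, norm_norm]
    apply le_of_eq
    field_simp
    ring
  refine hbound.trans_tendsto ?_
  have hnorm : Tendsto (fun p : ℝ × E => ‖p.2‖ ^ k) (𝓝[≠] 0 ×ˢ 𝓝 x) (𝓝 (‖x‖ ^ k)) :=
    (tendsto_snd.norm).pow k
  simpa using (tendsto_smul_punctured_prod_nhds x).norm.mul hnorm

theorem eq_zero_of_homogeneous_of_isBigO {h : E → F} {k : ℕ}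
    (hhom : ∀ (t : ℝ) z, h (t • z) = t ^ k • h z) (hh : h =O[𝓝 0] fun z => ‖z‖ ^ (k + 1)) :
    h = 0 := by
  funext z
  have hlim := (tendsto_inv_pow_smul_comp_smul hh z).comp
    (tendsto_id.prodMk (tendsto_const_nhds (x := z)))
  refine tendsto_nhds_unique (tendsto_const_nhds.congr' ?_) hlim
  filter_upwards [self_mem_nhdsWithin] with t (ht : t ≠ 0)
  simp only [Function.comp_apply, id_eq, hhom, inv_smul_smul₀ (pow_ne_zero k ht)]

-- The blow-ups `t⁻¹⁻ᵏ f (t y)` tend to `0`, while their derivatives tend to `h`.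
theorem eq_zero_of_fderiv_sub_homogeneous_isBigO {f : E → F} {h : E → E →L[ℝ] F} {k : ℕ}
    (hf : ∀ᶠ z in 𝓝 0, DifferentiableAt ℝ f z) (hfO : f =O[𝓝 0] fun z => ‖z‖ ^ (k + 2))
    (hhom : ∀ (t : ℝ) z, h (t • z) = t ^ k • h z)
    (hh : (fun z => fderiv ℝ f z - h z) =O[𝓝 0] fun z => ‖z‖ ^ (k + 1)) : h = 0 := by
  funext x
  have hne : ∀ᶠ p : ℝ × E in 𝓝[≠] 0 ×ˢ 𝓝 x, p.1 ≠ 0 :=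
    tendsto_fst.eventually self_mem_nhdsWithin
  have hderiv : ∀ᶠ p : ℝ × E in 𝓝[≠] 0 ×ˢ 𝓝 x, HasFDerivAt
      (fun y => (p.1 ^ (k + 1))⁻¹ • f (p.1 • y)) ((p.1 ^ k)⁻¹ • fderiv ℝ f (p.1 • p.2)) p.2 := by
    filter_upwards [hne, (tendsto_smul_punctured_prod_nhds x).eventually hf] with p hp hfp
    have hscale : HasFDerivAt (fun y : E => p.1 • y) (p.1 • ContinuousLinearMap.id ℝ E) p.2 :=
      (hasFDerivAt_id p.2).const_smul p.1
    have hcomp := (hfp.hasFDerivAt.comp p.2 hscale).const_smul (p.1 ^ (k + 1))⁻¹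
    have hpow : (p.1 ^ (k + 1))⁻¹ * p.1 = (p.1 ^ k)⁻¹ := by
      rw [pow_succ, mul_inv, inv_mul_cancel_right₀ hp]
    rwa [ContinuousLinearMap.comp_smul, ContinuousLinearMap.comp_id, smul_smul, hpow] at hcomp
  have huniform : TendstoUniformlyOnFilter (fun (t : ℝ) y => (t ^ k)⁻¹ • fderiv ℝ f (t • y)) h
      (𝓝[≠] 0) (𝓝 x) := by
    rw [Metric.tendstoUniformlyOnFilter_iff]
    intro ε hε
    filter_upwards [hne, (tendsto_inv_pow_smul_comp_smul hh x).eventually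
      (Metric.ball_mem_nhds 0 hε)] with p hp hball
    rwa [smul_sub, hhom, inv_smul_smul₀ (pow_ne_zero k hp), dist_zero_right, ← dist_eq_norm,
      dist_comm] at hball
  have hpointwise : ∀ y, Tendsto (fun t : ℝ => (t ^ (k + 1))⁻¹ • f (t • y)) (𝓝[≠] 0) (𝓝 0) :=
    fun y => (tendsto_inv_pow_smul_comp_smul hfO y).comp
      (tendsto_id.prodMk (tendsto_const_nhds (x := y)))
  exact (hasFDerivAt_of_tendstoUniformlyOnFilter huniform hderiv
    (Eventually.of_forall hpointwise)).unique (hasFDerivAt_const 0 x)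

end HomogeneousFunctions

section Taylor

variable {E F : Type*} [NormedAddCommGroup E] [NormedSpace ℝ E] [NormedAddCommGroup F]
  [NormedSpace ℝ F] {f : E → F} {m : ℕ}

/-- The homogeneous part of degree `k` of the Taylor expansion of `f` at the origin. -/
noncomputable def taylorPart (f : E → F) (k : ℕ) (z : E) : F :=
  (k.factorial : ℝ)⁻¹ • iteratedFDeriv ℝ k f 0 fun _ => z

theorem taylorPart_smul (f : E → F) (k : ℕ) (t : ℝ) (z : E) :
    taylorPart f k (t • z) = t ^ k • taylorPart f k z := by
  have h := (iteratedFDeriv ℝ k f 0).map_smul_univ (fun _ => t) fun _ => z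
  rw [Finset.prod_const, Finset.card_univ, Fintype.card_fin] at h
  rw [taylorPart, h, smul_comm, taylorPart]

variable [CompleteSpace F]

theorem norm_sub_sum_taylorPart_le {z : E} {K : ℝ}
    (hf : ∀ t ∈ Set.Icc (0 : ℝ) 1, ContDiffAt ℝ (m + 1) f (t • z))
    (hK : ∀ t ∈ Set.Icc (0 : ℝ) 1, ‖iteratedFDeriv ℝ (m + 1) f (t • z)‖ ≤ K) :
    ‖f z - ∑ k ∈ Finset.range (m + 1), taylorPart f k z‖ ≤
      (m.factorial : ℝ)⁻¹ * (K * ‖z‖ ^ (m + 1)) := by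
  have hintegrand : ∀ t ∈ Set.uIoc (0 : ℝ) 1,
      ‖(1 - t) ^ m • iteratedFDeriv ℝ (m + 1) f (t • z) fun _ => z‖ ≤ K * ‖z‖ ^ (m + 1) := by
    intro t ht
    rw [Set.uIoc_of_le zero_le_one] at ht
    have hweight : ‖(1 - t) ^ m‖ ≤ 1 := by
      rw [norm_pow, Real.norm_of_nonneg (by linarith [ht.2])]
      exact pow_le_one₀ (by linarith [ht.2]) (by linarith [ht.1])
    have hdiag : ‖iteratedFDeriv ℝ (m + 1) f (t • z) fun _ => z‖ ≤ K * ‖z‖ ^ (m + 1) :=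
      ((iteratedFDeriv ℝ (m + 1) f (t • z)).le_opNorm_mul_pow_of_le
        (pi_norm_const_le z)).trans (by gcongr; exact hK t (Set.Ioc_subset_Icc_self ht))
    rw [norm_smul]
    exact (mul_le_mul hweight hdiag (norm_nonneg _) zero_le_one).trans_eq (one_mul _)
  have hintegral := intervalIntegral.norm_integral_le_of_norm_le_const hintegrand
  have htaylor := map_add_eq_sum_add_integral_iteratedFDeriv (f := f) (x := 0) (y := z) (n := m)
    fun t ht => by simpa using hf t ht
  simp only [zero_add] at htaylor
  simp only [taylorPart]
  rw [htaylor, add_sub_cancel_left, norm_smul, norm_inv, Real.norm_natCast]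
  gcongr
  simpa using hintegral

theorem sub_sum_taylorPart_isBigO (hf : ContDiffAt ℝ m f 0) :
    (fun z => f z - ∑ k ∈ Finset.range m, taylorPart f k z) =O[𝓝 0] fun z => ‖z‖ ^ m := by
  cases m with
  | zero => simpa using hf.continuousAt.isBigO_one ℝ
  | succ m =>
    set K : ℝ := ‖iteratedFDeriv ℝ (m + 1) f 0‖ + 1
    have hbdd : ∀ᶠ z in 𝓝 (0 : E), ‖iteratedFDeriv ℝ (m + 1) f z‖ ≤ K :=
      ((hf.continuousAt_iteratedFDeriv le_rfl).norm.eventually_lt_const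
        (lt_add_one _)).mono fun _ => le_of_lt
    obtain ⟨δ, hδ, hball⟩ := Metric.eventually_nhds_iff_ball.1 ((hf.eventually (by simp)).and hbdd)
    refine IsBigO.of_bound ((m.factorial : ℝ)⁻¹ * K) ?_
    filter_upwards [Metric.ball_mem_nhds 0 hδ] with z hz
    have hseg : ∀ t ∈ Set.Icc (0 : ℝ) 1, t • z ∈ Metric.ball (0 : E) δ := fun t ht =>
      (convex_ball (0 : E) δ).smul_mem_of_zero_mem (Metric.mem_ball_self hδ) hz ht
    rw [norm_pow, norm_norm, mul_assoc]
    exact norm_sub_sum_taylorPart_le (fun t ht => mod_cast (hball _ (hseg t ht)).1)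
      fun t ht => (hball _ (hseg t ht)).2

theorem taylorPart_eq_zero_of_isBigO (hf : ContDiffAt ℝ m f 0) (hfO : f =O[𝓝 0] fun z => ‖z‖ ^ m) :
    ∀ k < m, taylorPart f k = 0 := by
  intro k
  induction k using Nat.strong_induction_on with
  | _ k ih =>
    intro hk
    refine eq_zero_of_homogeneous_of_isBigO (taylorPart_smul f k) ?_
    have hlower : (fun z => f z - taylorPart f k z) =O[𝓝 0] fun z => ‖z‖ ^ (k + 1) := by
      refine (sub_sum_taylorPart_isBigO
        (hf.of_le (by exact_mod_cast hk) : ContDiffAt ℝ (k + 1 : ℕ) f 0)).congr_left fun z => ?_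
      rw [Finset.sum_range_succ, Finset.sum_eq_zero, zero_add]
      exact fun j hj => congrFun
        (ih j (Finset.mem_range.1 hj) ((Finset.mem_range.1 hj).trans hk)) z
    simpa using (hfO.trans (isBigO_norm_pow_of_le hk)).sub hlower

theorem sub_taylorPart_isBigO (hf : ContDiffAt ℝ (m + 1) f 0)
    (hfO : f =O[𝓝 0] fun z => ‖z‖ ^ m) :
    (fun z => f z - taylorPart f m z) =O[𝓝 0] fun z => ‖z‖ ^ (m + 1) := by
  refine (sub_sum_taylorPart_isBigO (m := m + 1) (mod_cast hf)).congr_left fun z => ?_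
  rw [Finset.sum_range_succ, Finset.sum_eq_zero, zero_add]
  exact fun j hj => congrFun (taylorPart_eq_zero_of_isBigO (hf.of_le (by simp)) hfO j
    (Finset.mem_range.1 hj)) z

theorem fderiv_isBigO (hf : ContDiffAt ℝ (m + 1) f 0) (hfO : f =O[𝓝 0] fun z => ‖z‖ ^ (m + 1)) :
    fderiv ℝ f =O[𝓝 0] fun z => ‖z‖ ^ m := by
  have hdiff : ∀ᶠ z in 𝓝 0, DifferentiableAt ℝ f z :=
    (hf.eventually (by simp)).mono fun z hz => hz.differentiableAt (by simp)
  have hfderiv : ContDiffAt ℝ m (fderiv ℝ f) 0 := hf.fderiv_right le_rfl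
  suffices h : ∀ k ≤ m, fderiv ℝ f =O[𝓝 0] fun z => ‖z‖ ^ k from h m le_rfl
  intro k hk
  induction k with
  | zero => simpa using hfderiv.continuousAt.isBigO_one ℝ
  | succ k ih =>
    have hlead := sub_taylorPart_isBigO (hfderiv.of_le (by exact_mod_cast hk)) (ih (by lia))
    have hzero : taylorPart (fderiv ℝ f) k = 0 := eq_zero_of_fderiv_sub_homogeneous_isBigO hdiff
      (hfO.trans (isBigO_norm_pow_of_le (by lia))) (taylorPart_smul _ k) hlead
    simpa [hzero] using hlead

end Taylor

section PowerSpan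

theorem mem_of_forall_sum_pow_smul_mem {V : Type*} [AddCommGroup V] [Module ℝ V]
    {W : Submodule ℝ V} {n : ℕ} {v : ℕ → V}
    (h : ∀ t : ℝ, ∑ j ∈ Finset.range n, t ^ j • v j ∈ W) {j : ℕ} (hj : j < n) : v j ∈ W := by
  by_contra hv
  obtain ⟨φ, hφ, hker⟩ := Submodule.exists_le_ker_of_notMem hv
  let p : Polynomial ℝ := ∑ i ∈ Finset.range n, Polynomial.monomial i (φ (v i))
  have hp : p = 0 := Polynomial.funext fun t => by
    simpa [p, Polynomial.eval_finsetSum, mul_comm] using hker (h t)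
  have hcoeff : p.coeff j = φ (v j) := by
    simp [p, Polynomial.coeff_monomial, hj]
  exact hφ (by rw [← hcoeff, hp, Polynomial.coeff_zero])

variable {E : Type*} [NormedAddCommGroup E] [NormedSpace ℝ E] {m : ℕ}

/-- The span of the `m`-th powers of continuous linear forms. In finite dimension these are the
homogeneous polynomial functions of degree `m`. -/
def powerSpan (E : Type*) [NormedAddCommGroup E] [NormedSpace ℝ E] (m : ℕ) :
    Submodule ℝ (E → ℝ) :=
  Submodule.span ℝ (Set.range fun (ℓ : E →L[ℝ] ℝ) (z : E) => ℓ z ^ m)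

theorem pow_mem_powerSpan (ℓ : E →L[ℝ] ℝ) (m : ℕ) : (fun z => ℓ z ^ m) ∈ powerSpan E m :=
  Submodule.subset_span ⟨ℓ, rfl⟩

theorem const_mem_powerSpan_zero (c : ℝ) : (fun _ => c) ∈ powerSpan E 0 := by
  simpa [Pi.smul_def] using (powerSpan E 0).smul_mem c (pow_mem_powerSpan 0 0)

-- The coefficient of `t` in `(t x + y) ^ (m + 1)` is `(m + 1) x y ^ m`.
theorem linear_mul_pow_mem_powerSpan (x y : E →L[ℝ] ℝ) (m : ℕ) :
    (fun z => x z * y z ^ m) ∈ powerSpan E (m + 1) := by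
  have hexpand : ∀ t : ℝ, ∑ j ∈ Finset.range (m + 2),
      t ^ j • (fun z => x z ^ j * y z ^ (m + 1 - j) * ((m + 1).choose j : ℝ)) ∈
        powerSpan E (m + 1) := by
    intro t
    convert pow_mem_powerSpan (t • x + y) (m + 1) using 1
    funext z
    simp only [Finset.sum_apply, Pi.smul_apply, smul_eq_mul, add_apply, smul_apply, add_pow,
      mul_pow]
    exact Finset.sum_congr rfl fun j _ => by ring
  have hlin := mem_of_forall_sum_pow_smul_mem hexpand (j := 1) (by lia)
  convert (powerSpan E (m + 1)).smul_mem ((m : ℝ) + 1)⁻¹ hlin using 1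
  funext z
  simp only [Pi.smul_apply, smul_eq_mul, pow_one, Nat.add_sub_cancel, Nat.choose_one_right]
  push_cast
  field_simp

theorem linear_mul_mem_powerSpan (x : E →L[ℝ] ℝ) {f : E → ℝ} (hf : f ∈ powerSpan E m) :
    (fun z => x z * f z) ∈ powerSpan E (m + 1) := by
  have hle : powerSpan E m ≤ (powerSpan E (m + 1)).comap (LinearMap.mulLeft ℝ (x : E → ℝ)) := by
    rw [powerSpan, Submodule.span_le]
    rintro _ ⟨y, rfl⟩
    exact linear_mul_pow_mem_powerSpan x y m
  exact hle hf

theorem contDiff_of_mem_powerSpan {f : E → ℝ} (hf : f ∈ powerSpan E m) {k : WithTop ℕ∞} :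
    ContDiff ℝ k f := by
  induction hf using Submodule.span_induction with
  | mem f hf => obtain ⟨y, rfl⟩ := hf; exact y.contDiff.pow m
  | zero => exact contDiff_const
  | add f g _ _ hf hg => exact hf.add hg
  | smul a f _ hf => exact contDiff_const.smul hf

theorem isBigO_of_mem_powerSpan {f : E → ℝ} (hf : f ∈ powerSpan E m) (l : Filter E) :
    f =O[l] fun z => ‖z‖ ^ m := by
  induction hf using Submodule.span_induction with
  | mem f hf => obtain ⟨y, rfl⟩ := hf; exact (y.isBigO_id l).norm_right.pow m
  | zero => exact isBigO_zero _ _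
  | add f g _ _ hf hg => exact hf.add hg
  | smul a f _ hf => exact hf.const_smul_left a

theorem multilinear_diag_mem_powerSpan [FiniteDimensional ℝ E]
    (A : ContinuousMultilinearMap ℝ (fun _ : Fin m => E) ℝ) :
    (fun z => A fun _ => z) ∈ powerSpan E m := by
  induction m with
  | zero =>
    have hconst : (fun z => A fun _ => z) = fun _ => A 0 :=
      funext fun z => congrArg A (Subsingleton.elim _ _)
    exact hconst ▸ const_mem_powerSpan_zero (A 0)
  | succ m ih =>
    let b := Module.finBasis ℝ E
    have hexpand : (fun z => A fun _ => z) =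
        ∑ i, fun z => LinearMap.toContinuousLinearMap (b.coord i) z *
          A.curryLeft (b i) fun _ => z := by
      funext z
      have hcons : (fun _ : Fin (m + 1) => z) = Fin.cons z fun _ => z :=
        (Fin.cons_self_tail _).symm
      have hlin : A.curryLeft z = ∑ i, b.repr z i • A.curryLeft (b i) := by
        simp_rw [← map_smul, ← map_sum, b.sum_repr]
      rw [hcons, ← ContinuousMultilinearMap.curryLeft_apply, hlin]
      simp
    rw [hexpand]
    exact Submodule.sum_mem _ fun i _ => linear_mul_mem_powerSpan _ (ih _)

theorem taylorPart_mem_powerSpan [FiniteDimensional ℝ E] (f : E → ℝ) (m : ℕ) :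
    taylorPart f m ∈ powerSpan E m :=
  (powerSpan E m).smul_mem _ (multilinear_diag_mem_powerSpan _)

end PowerSpan

section PhaseSpace

variable {n : ℕ}

/-- The linear isomorphism between covectors and vectors given by the symplectic form: it sends
the differential of `H` to the Hamiltonian vector of `H`. -/
noncomputable def hamVector : (Phase n →L[ℝ] ℝ) →L[ℝ] Phase n :=
  LinearMap.toContinuousLinearMap
    { toFun := fun β => WithLp.toLp 2
        (Sum.elim (fun j => β (EuclideanSpace.single (Sum.inr j) 1))
          (fun j => -β (EuclideanSpace.single (Sum.inl j) 1)))
      map_add' := fun α β => by ext (j | j) <;> simp [add_comm]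
      map_smul' := fun a β => by ext (j | j) <;> simp }

@[simp]
theorem hamVector_inl (β : Phase n →L[ℝ] ℝ) (j : Fin n) :
    hamVector β (Sum.inl j) = β (EuclideanSpace.single (Sum.inr j) 1) :=
  rfl

@[simp]
theorem hamVector_inr (β : Phase n →L[ℝ] ℝ) (j : Fin n) :
    hamVector β (Sum.inr j) = -β (EuclideanSpace.single (Sum.inl j) 1) :=
  rfl

theorem hamVectorField_eq (H : Phase n → ℝ) : hamVectorField H = hamVector ∘ fderiv ℝ H :=
  rfl

theorem apply_eq_sum_single (α : Phase n →L[ℝ] ℝ) (z : Phase n) :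
    α z = ∑ j, (z (Sum.inl j) * α (EuclideanSpace.single (Sum.inl j) 1)
      + z (Sum.inr j) * α (EuclideanSpace.single (Sum.inr j) 1)) := by
  have h := congrArg α ((EuclideanSpace.basisFun (Fin n ⊕ Fin n) ℝ).sum_repr z)
  rw [map_sum] at h
  rw [← h, Fintype.sum_sum_type, ← Finset.sum_add_distrib]
  simp

theorem apply_hamVector (α β : Phase n →L[ℝ] ℝ) : α (hamVector β) = -β (hamVector α) := by
  rw [apply_eq_sum_single α, apply_eq_sum_single β, ← Finset.sum_neg_distrib]
  refine Finset.sum_congr rfl fun j _ => ?_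
  simp only [hamVector_inl, hamVector_inr]
  ring

theorem apply_hamVector_self (α : Phase n →L[ℝ] ℝ) : α (hamVector α) = 0 :=
  self_eq_neg.1 (apply_hamVector α α)

theorem poissonBracket_eq (F G : Phase n → ℝ) (z : Phase n) :
    poissonBracket F G z = fderiv ℝ F z (hamVectorField G z) := by
  rw [apply_eq_sum_single (fderiv ℝ F z), poissonBracket]
  refine Finset.sum_congr rfl fun j _ => ?_
  simp only [hamVectorField, dq, dp, Sum.elim_inl, Sum.elim_inr]
  ring

theorem hasFDerivAt_action (j : Fin n) (z : Phase n) :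
    HasFDerivAt (action j)
      (z (Sum.inr j) • (EuclideanSpace.proj (Sum.inr j) : Phase n →L[ℝ] ℝ)
        + z (Sum.inl j) • (EuclideanSpace.proj (Sum.inl j) : Phase n →L[ℝ] ℝ)) z := by
  have hp := ((EuclideanSpace.proj (Sum.inr j) : Phase n →L[ℝ] ℝ).hasFDerivAt (x := z)).pow 2
  have hq := ((EuclideanSpace.proj (Sum.inl j) : Phase n →L[ℝ] ℝ).hasFDerivAt (x := z)).pow 2
  refine ((hp.add hq).mul_const (2⁻¹ : ℝ)).congr_fderiv ?_
  ext v
  simp only [PiLp.proj_apply, Nat.add_one_sub_one, pow_one, nsmul_eq_mul, Nat.cast_ofNat, smul_add,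
    add_apply, smul_apply, smul_eq_mul]
  ring

theorem fderiv_action_apply (j : Fin n) (z v : Phase n) :
    fderiv ℝ (action j) z v = z (Sum.inr j) * v (Sum.inr j) + z (Sum.inl j) * v (Sum.inl j) := by
  rw [(hasFDerivAt_action j z).fderiv]
  rfl

theorem contDiff_action (j : Fin n) {k : WithTop ℕ∞} :
    ContDiff ℝ k (action j : Phase n → ℝ) := by
  unfold action
  fun_prop

theorem contDiff_harmonic (ω : Fin n → ℝ) {k : WithTop ℕ∞} : ContDiff ℝ k (harmonic ω) :=
  ContDiff.sum fun j _ => contDiff_const.mul (contDiff_action j)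

theorem action_nonneg (j : Fin n) (z : Phase n) : 0 ≤ action j z := by
  rw [action]
  positivity

theorem norm_sq_eq_sum_action (z : Phase n) : ‖z‖ ^ 2 = ∑ j, 2 * action j z := by
  rw [EuclideanSpace.real_norm_sq_eq, Fintype.sum_sum_type, ← Finset.sum_add_distrib]
  refine Finset.sum_congr rfl fun j _ => ?_
  rw [action]
  ring

theorem two_mul_action_le_norm_sq (j : Fin n) (z : Phase n) : 2 * action j z ≤ ‖z‖ ^ 2 := by
  rw [norm_sq_eq_sum_action]
  exact Finset.single_le_sum (f := fun j => 2 * action j z)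
    (fun i _ => mul_nonneg zero_le_two (action_nonneg i z)) (Finset.mem_univ j)

theorem action_isBigO (j : Fin n) (l : Filter (Phase n)) :
    action j =O[l] fun z => ‖z‖ ^ 2 := by
  refine IsBigO.of_bound 1 (Eventually.of_forall fun z => ?_)
  rw [Real.norm_of_nonneg (action_nonneg j z), Real.norm_of_nonneg (by positivity)]
  linarith [two_mul_action_le_norm_sq j z, action_nonneg j z]

theorem abs_fderiv_action_le (j : Fin n) (z v : Phase n) :
    |fderiv ℝ (action j) z v| ≤ √(2 * action j z) * ‖v‖ := by
  have hcauchy : fderiv ℝ (action j) z v ^ 2 ≤ 2 * action j z * (2 * action j v) := by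
    rw [fderiv_action_apply]
    simp only [action]
    nlinarith [sq_nonneg (z (Sum.inr j) * v (Sum.inl j) - z (Sum.inl j) * v (Sum.inr j))]
  calc |fderiv ℝ (action j) z v|
    _ ≤ √(2 * action j z * (2 * action j v)) := Real.abs_le_sqrt hcauchy
    _ = √(2 * action j z) * √(2 * action j v) :=
        Real.sqrt_mul (mul_nonneg zero_le_two (action_nonneg j z)) _
    _ ≤ √(2 * action j z) * ‖v‖ := by
        gcongr
        exact Real.sqrt_le_iff.2 ⟨norm_nonneg v, two_mul_action_le_norm_sq j v⟩

theorem fderiv_harmonic_apply (ω : Fin n → ℝ) (z v : Phase n) :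
    fderiv ℝ (harmonic ω) z v = ∑ j, ω j * fderiv ℝ (action j) z v := by
  have hd (j : Fin n) : DifferentiableAt ℝ (action j) z :=
    (contDiff_action j (k := 1)).differentiable one_ne_zero z
  have h : HasFDerivAt (harmonic ω) (∑ j, ω j • fderiv ℝ (action j) z) z :=
    HasFDerivAt.fun_sum fun j _ => (hd j).hasFDerivAt.const_mul (ω j)
  simp [h.fderiv]

theorem hamVectorField_harmonic_inl (ω : Fin n → ℝ) (z : Phase n) (j : Fin n) :
    hamVectorField (harmonic ω) z (Sum.inl j) = ω j * z (Sum.inr j) := by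
  simp [hamVectorField, dp, fderiv_harmonic_apply, fderiv_action_apply]

theorem hamVectorField_harmonic_inr (ω : Fin n → ℝ) (z : Phase n) (j : Fin n) :
    hamVectorField (harmonic ω) z (Sum.inr j) = -(ω j * z (Sum.inl j)) := by
  simp [hamVectorField, dq, fderiv_harmonic_apply, fderiv_action_apply]

end PhaseSpace

section ActionPolynomials

variable {n : ℕ}

/-- The function `Z(I₁, …, Iₙ)` on the phase space. -/
noncomputable def actionEval (Z : MvPolynomial (Fin n) ℝ) (z : Phase n) : ℝ :=
  MvPolynomial.eval (fun j => action j z) Z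

theorem contDiff_actionEval (Z : MvPolynomial (Fin n) ℝ) {k : WithTop ℕ∞} :
    ContDiff ℝ k (actionEval Z) := by
  have hfun : actionEval Z = fun z =>
      ∑ d ∈ Z.support, Z.coeff d * ∏ j, action j z ^ d j :=
    funext fun z => MvPolynomial.eval_eq' _ Z
  rw [hfun]
  exact ContDiff.sum fun d _ =>
    contDiff_const.mul (contDiff_prod fun j _ => (contDiff_action j).pow _)

theorem actionEval_add (Z Z' : MvPolynomial (Fin n) ℝ) :
    actionEval (Z + Z') = actionEval Z + actionEval Z' := by
  funext z
  simp [actionEval]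

theorem exists_actionEval_eq_harmonic_add (ω : Fin n → ℝ) (Z : MvPolynomial (Fin n) ℝ) :
    ∃ Φ : MvPolynomial (Fin n) ℝ, actionEval Φ = harmonic ω + actionEval Z := by
  refine ⟨(∑ j, MvPolynomial.C (ω j) * MvPolynomial.X j) + Z, ?_⟩
  rw [actionEval_add]
  congr 1
  funext z
  simp [harmonic, actionEval]

theorem fderiv_actionEval_apply_eq_zero (Z : MvPolynomial (Fin n) ℝ) {z v : Phase n}
    (hv : ∀ j, fderiv ℝ (action j) z v = 0) : fderiv ℝ (actionEval Z) z v = 0 := by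
  have hd (p : MvPolynomial (Fin n) ℝ) : DifferentiableAt ℝ (actionEval p) z :=
    (contDiff_actionEval p (k := 1)).differentiable one_ne_zero z
  induction Z using MvPolynomial.induction_on with
  | C a =>
    have hconst : actionEval (MvPolynomial.C a) = fun _ : Phase n => a :=
      funext fun w => MvPolynomial.eval_C a
    simp [hconst]
  | add p q hp hq =>
    rw [actionEval_add, fderiv_add (hd p) (hd q), add_apply, hp, hq, add_zero]
  | mul_X p j hp =>
    have hmul : actionEval (p * MvPolynomial.X j) = actionEval p * action j := by
      funext w
      simp [actionEval]
    rw [hmul, fderiv_mul (hd p) ((contDiff_action j (k := 1)).differentiable one_ne_zero z)]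
    simp [hp, hv]

theorem fderiv_action_hamVectorField_actionEval (Z : MvPolynomial (Fin n) ℝ) (j : Fin n)
    (z : Phase n) : fderiv ℝ (action j) z (hamVectorField (actionEval Z) z) = 0 := by
  change fderiv ℝ (action j) z (hamVector (fderiv ℝ (actionEval Z) z)) = 0
  rw [apply_hamVector, fderiv_actionEval_apply_eq_zero, neg_zero]
  intro k
  rw [fderiv_action_apply, hamVector_inl, hamVector_inr, fderiv_action_apply, fderiv_action_apply]
  rcases eq_or_ne k j with rfl | hkj
  · simp only [ne_eq, reduceCtorEq, not_false_eq_true, PiLp.single_eq_of_ne, mul_zero,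
      PiLp.single_eq_same, mul_one, zero_add, mul_neg, add_zero]
    ring
  · simp [hkj]

theorem actionEval_monomial_isBigO (d : Fin n →₀ ℕ) (a : ℝ) (l : Filter (Phase n)) :
    actionEval (MvPolynomial.monomial d a) =O[l] fun z => ‖z‖ ^ (2 * d.degree) := by
  have hprod : (fun z : Phase n => ∏ j, action j z ^ d j) =O[l]
      fun z => ∏ j, (‖z‖ ^ 2) ^ d j :=
    IsBigO.finsetProd fun j _ => (action_isBigO j l).pow (d j)
  refine (hprod.const_mul_left a).congr (fun z => ?_) fun z => ?_
  · rw [actionEval, MvPolynomial.eval_monomial, Finsupp.prod_fintype _ _ fun j => pow_zero _]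
  · rw [Finset.prod_pow_eq_pow_sum, ← pow_mul, Finsupp.degree_eq_sum]

theorem exists_totalDegree_le_actionEval_sub_isBigO (Z : MvPolynomial (Fin n) ℝ) (r : ℕ) :
    ∃ Z' : MvPolynomial (Fin n) ℝ, 2 * Z'.totalDegree ≤ r ∧
      (actionEval Z - actionEval Z') =O[𝓝 0] fun z => ‖z‖ ^ (r + 1) := by
  induction Z using MvPolynomial.induction_on' with
  | monomial d a =>
    by_cases hd : 2 * d.degree ≤ r
    · refine ⟨MvPolynomial.monomial d a, ?_, ?_⟩
      · exact (Nat.mul_le_mul_left 2 (MvPolynomial.totalDegree_monomial_le d a)).trans hd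
      · rw [sub_self]
        exact isBigO_zero _ _
    · refine ⟨0, by simp, ?_⟩
      have hzero : actionEval (0 : MvPolynomial (Fin n) ℝ) = 0 := funext fun z => map_zero _
      rw [hzero, sub_zero]
      exact (actionEval_monomial_isBigO d a _).trans (isBigO_norm_pow_of_le (by omega))
  | add p q hp hq =>
    obtain ⟨p', hp', hpO⟩ := hp
    obtain ⟨q', hq', hqO⟩ := hq
    refine ⟨p' + q', ?_, ?_⟩
    · have := MvPolynomial.totalDegree_add p' q'
      omega
    · rw [actionEval_add, actionEval_add, add_sub_add_comm]
      exact hpO.add hqO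

end ActionPolynomials

section Homological

variable {n : ℕ} {ω : Fin n → ℝ} {m : ℕ} {f g : Phase n → ℝ}

/-- The frequency vector `ω` has no non-trivial integer relation of length at most `N`. -/
def NonResonantUpTo (N : ℕ) (ω : Fin n → ℝ) : Prop :=
  ∀ k : Fin n → ℤ, k ≠ 0 → ∑ j, |k j| ≤ N → ∑ j, (k j : ℝ) * ω j ≠ 0

theorem NonResonant.nonResonantUpTo (hω : NonResonant ω) (N : ℕ) : NonResonantUpTo N ω :=
  fun k hk _ => hω k hk

theorem NonResonantUpTo.mono {N N' : ℕ} (hω : NonResonantUpTo N' ω) (h : N ≤ N') :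
    NonResonantUpTo N ω :=
  fun k hk hkN => hω k hk (hkN.trans (mod_cast h))

/-- The complex coordinates `q_j + i p_j` (left summand) and `q_j - i p_j` (right summand), in
which the harmonic flow is diagonal. -/
noncomputable def complexCoord : Fin n ⊕ Fin n → Phase n →L[ℝ] ℂ
  | Sum.inl j => Complex.ofRealCLM.comp (EuclideanSpace.proj (Sum.inl j))
      + Complex.I • Complex.ofRealCLM.comp (EuclideanSpace.proj (Sum.inr j))
  | Sum.inr j => Complex.ofRealCLM.comp (EuclideanSpace.proj (Sum.inl j))
      - Complex.I • Complex.ofRealCLM.comp (EuclideanSpace.proj (Sum.inr j))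

/-- The eigenvalues of the harmonic vector field in the complex coordinates. -/
noncomputable def harmonicEigenvalue (ω : Fin n → ℝ) : Fin n ⊕ Fin n → ℂ
  | Sum.inl j => -(Complex.I * ω j)
  | Sum.inr j => Complex.I * ω j

theorem complexCoord_inl (j : Fin n) (z : Phase n) :
    complexCoord (Sum.inl j) z = z (Sum.inl j) + Complex.I * z (Sum.inr j) :=
  rfl

theorem complexCoord_inr (j : Fin n) (z : Phase n) :
    complexCoord (Sum.inr j) z = z (Sum.inl j) - Complex.I * z (Sum.inr j) :=
  rfl

theorem complexCoord_inl_mul_inr (j : Fin n) (z : Phase n) :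
    complexCoord (Sum.inl j) z * complexCoord (Sum.inr j) z = (2 * action j z : ℝ) := by
  rw [complexCoord_inl, complexCoord_inr, action]
  push_cast
  linear_combination -(z (Sum.inr j) : ℂ) ^ 2 * Complex.I_sq

theorem complexCoord_hamVectorField_harmonic (ω : Fin n → ℝ) (s : Fin n ⊕ Fin n) (z : Phase n) :
    complexCoord s (hamVectorField (harmonic ω) z) = harmonicEigenvalue ω s * complexCoord s z := by
  rcases s with j | j <;>
  · simp only [complexCoord_inl, complexCoord_inr, harmonicEigenvalue, hamVectorField_harmonic_inl,
      hamVectorField_harmonic_inr]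
    push_cast
    linear_combination (ω j * z (Sum.inr j) : ℂ) * Complex.I_sq

theorem exists_ofReal_apply_eq_sum_complexCoord (ℓ : Phase n →L[ℝ] ℝ) :
    ∃ a : Fin n ⊕ Fin n → ℂ, ∀ z, (ℓ z : ℂ) = ∑ s, a s * complexCoord s z := by
  refine ⟨Sum.elim
    (fun j => (ℓ (EuclideanSpace.single (Sum.inl j) 1)
      - Complex.I * ℓ (EuclideanSpace.single (Sum.inr j) 1)) / 2)
    (fun j => (ℓ (EuclideanSpace.single (Sum.inl j) 1)
      + Complex.I * ℓ (EuclideanSpace.single (Sum.inr j) 1)) / 2), fun z => ?_⟩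
  rw [apply_eq_sum_single, Complex.ofReal_sum, Fintype.sum_sum_type, ← Finset.sum_add_distrib]
  refine Finset.sum_congr rfl fun j _ => ?_
  rw [Sum.elim_inl, Sum.elim_inr, complexCoord_inl, complexCoord_inr]
  push_cast
  linear_combination
    (z (Sum.inr j) * ℓ (EuclideanSpace.single (Sum.inr j) 1) : ℂ) * Complex.I_sq

/-- The monomial in the complex coordinates whose factors are listed in `S`. -/
noncomputable def complexMonomial (S : Multiset (Fin n ⊕ Fin n)) (z : Phase n) : ℂ :=
  (S.map fun s => complexCoord s z).prod

theorem complexMonomial_zero : complexMonomial (0 : Multiset (Fin n ⊕ Fin n)) = fun _ => 1 :=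
  rfl

theorem complexMonomial_cons (s : Fin n ⊕ Fin n) (S : Multiset (Fin n ⊕ Fin n)) :
    complexMonomial (s ::ₘ S) = fun z => complexCoord s z * complexMonomial S z := by
  funext z
  rw [complexMonomial, Multiset.map_cons, Multiset.prod_cons, complexMonomial]

theorem re_mul_complexMonomial_mem_powerSpan (S : Multiset (Fin n ⊕ Fin n)) (c : ℂ) :
    (fun z => (c * complexMonomial S z).re) ∈ powerSpan (Phase n) S.card := by
  induction S using Multiset.induction_on generalizing c with
  | empty => simpa [complexMonomial_zero] using const_mem_powerSpan_zero c.re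
  | cons s S ih =>
    have hre := linear_mul_mem_powerSpan (Complex.reCLM.comp (complexCoord s)) (ih c)
    have him := linear_mul_mem_powerSpan (Complex.imCLM.comp (complexCoord s)) (ih (Complex.I * c))
    rw [Multiset.card_cons]
    convert add_mem hre him using 1
    funext z
    simp only [complexMonomial_cons, Complex.mul_re, Complex.mul_im,
      ContinuousLinearMap.comp_apply, Complex.reCLM_apply, Complex.imCLM_apply, Complex.I_re,
      zero_mul, Complex.I_im, one_mul, zero_sub, neg_mul, zero_add, Pi.add_apply]
    ring

/-- The span of the real parts of the complex monomials of degree `m` with complex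
coefficients. -/
def reMonomialSpan (n m : ℕ) : Submodule ℝ (Phase n → ℝ) :=
  Submodule.span ℝ {f | ∃ (S : Multiset (Fin n ⊕ Fin n)) (c : ℂ),
    S.card = m ∧ f = fun z => (c * complexMonomial S z).re}

theorem linear_mul_mem_reMonomialSpan (ℓ : Phase n →L[ℝ] ℝ) (hf : f ∈ reMonomialSpan n m) :
    (fun z => ℓ z * f z) ∈ reMonomialSpan n (m + 1) := by
  obtain ⟨a, ha⟩ := exists_ofReal_apply_eq_sum_complexCoord ℓ
  have hle : reMonomialSpan n m ≤
      (reMonomialSpan n (m + 1)).comap (LinearMap.mulLeft ℝ (ℓ : Phase n → ℝ)) := by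
    rw [reMonomialSpan, Submodule.span_le]
    rintro _ ⟨S, c, hS, rfl⟩
    have hmul : (fun z => ℓ z * (c * complexMonomial S z).re)
        = ∑ s, fun z => (c * a s * complexMonomial (s ::ₘ S) z).re := by
      funext z
      rw [Finset.sum_apply, ← Complex.re_sum, ← Complex.re_ofReal_mul, ha, Finset.sum_mul]
      simp only [complexMonomial_cons, mul_assoc, mul_left_comm c]
    change (fun z => ℓ z * (c * complexMonomial S z).re) ∈ reMonomialSpan n (m + 1)
    rw [hmul]
    exact sum_mem fun s _ => Submodule.subset_span
      ⟨s ::ₘ S, c * a s, by rw [Multiset.card_cons, hS], rfl⟩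
  exact hle hf

theorem powerSpan_le_reMonomialSpan (n m : ℕ) : powerSpan (Phase n) m ≤ reMonomialSpan n m := by
  rw [powerSpan, Submodule.span_le]
  rintro _ ⟨ℓ, rfl⟩
  induction m with
  | zero => exact Submodule.subset_span ⟨0, 1, rfl, by simp [complexMonomial_zero]⟩
  | succ m ih => simpa only [pow_succ', SetLike.mem_coe] using linear_mul_mem_reMonomialSpan ℓ ih

theorem differentiable_complexMonomial (S : Multiset (Fin n ⊕ Fin n)) :
    Differentiable ℝ (complexMonomial S) := by
  induction S using Multiset.induction_on with
  | empty => exact differentiable_const 1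
  | cons s S ih =>
    rw [complexMonomial_cons]
    exact (complexCoord s).differentiable.mul ih

theorem fderiv_complexMonomial_hamVectorField_harmonic (ω : Fin n → ℝ)
    (S : Multiset (Fin n ⊕ Fin n)) (z : Phase n) :
    fderiv ℝ (complexMonomial S) z (hamVectorField (harmonic ω) z)
      = (S.map (harmonicEigenvalue ω)).sum * complexMonomial S z := by
  induction S using Multiset.induction_on with
  | empty => simp [complexMonomial_zero]
  | cons s S ih =>
    rw [complexMonomial_cons, fderiv_fun_mul (complexCoord s).differentiableAt
      (differentiable_complexMonomial S z)]
    simp only [add_apply, smul_apply, smul_eq_mul, ih, (complexCoord s).fderiv,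
      complexCoord_hamVectorField_harmonic, Multiset.map_cons, Multiset.sum_cons]
    ring

@[to_additive]
theorem prod_map_eq_prod_pow_count {M : Type*} [CommMonoid M] (S : Multiset (Fin n ⊕ Fin n))
    (φ : Fin n ⊕ Fin n → M) : (S.map φ).prod =
      ∏ j, φ (Sum.inl j) ^ S.count (Sum.inl j) * φ (Sum.inr j) ^ S.count (Sum.inr j) := by
  rw [Finset.prod_multiset_map_count, Finset.prod_subset (Finset.subset_univ _),
    Fintype.prod_sum_type, ← Finset.prod_mul_distrib]
  intro s _ hs
  rw [Multiset.count_eq_zero_of_notMem (by simpa using hs), pow_zero]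

theorem card_eq_sum_count (S : Multiset (Fin n ⊕ Fin n)) :
    S.card = ∑ j, (S.count (Sum.inl j) + S.count (Sum.inr j)) := by
  rw [Finset.sum_add_distrib, ← Fintype.sum_sum_type (fun s => S.count s)]
  exact (Multiset.sum_count_eq_card fun a _ => Finset.mem_univ a).symm

theorem sum_map_harmonicEigenvalue (ω : Fin n → ℝ) (S : Multiset (Fin n ⊕ Fin n)) :
    (S.map (harmonicEigenvalue ω)).sum = -Complex.I * ((∑ j,
      (((S.count (Sum.inl j) : ℤ) - S.count (Sum.inr j) : ℤ) : ℝ) * ω j : ℝ) : ℂ) := by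
  rw [sum_map_eq_sum_nsmul_count, Complex.ofReal_sum, Finset.mul_sum]
  refine Finset.sum_congr rfl fun j _ => ?_
  simp only [harmonicEigenvalue, nsmul_eq_mul]
  push_cast
  ring

/-- The homological equation `f = {G, H₀} + Z` of order `m` has a solution with `Z` a polynomial
in the actions. -/
def HasHomologicalSolution (ω : Fin n → ℝ) (m : ℕ) (f : Phase n → ℝ) : Prop :=
  ∃ G ∈ powerSpan (Phase n) m, ∃ Z : MvPolynomial (Fin n) ℝ,
    ∀ z, f z = fderiv ℝ G z (hamVectorField (harmonic ω) z) + actionEval Z z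

theorem hasHomologicalSolution_zero (ω : Fin n → ℝ) (m : ℕ) :
    HasHomologicalSolution ω m 0 :=
  ⟨0, Submodule.zero_mem _, 0, by simp [actionEval]⟩

theorem HasHomologicalSolution.add (hf : HasHomologicalSolution ω m f)
    (hg : HasHomologicalSolution ω m g) : HasHomologicalSolution ω m (f + g) := by
  obtain ⟨G, hG, Z, h⟩ := hf
  obtain ⟨G', hG', Z', h'⟩ := hg
  refine ⟨G + G', add_mem hG hG', Z + Z', fun z => ?_⟩
  rw [fderiv_add ((contDiff_of_mem_powerSpan hG (k := 1)).differentiable one_ne_zero z)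
    ((contDiff_of_mem_powerSpan hG' (k := 1)).differentiable one_ne_zero z), actionEval_add]
  simp only [Pi.add_apply, add_apply, h, h']
  ring

theorem HasHomologicalSolution.smul (hf : HasHomologicalSolution ω m f) (a : ℝ) :
    HasHomologicalSolution ω m (a • f) := by
  obtain ⟨G, hG, Z, h⟩ := hf
  refine ⟨a • G, Submodule.smul_mem _ a hG, a • Z, fun z => ?_⟩
  rw [fderiv_const_smul ((contDiff_of_mem_powerSpan hG (k := 1)).differentiable one_ne_zero z)]
  simp [h, actionEval, MvPolynomial.smul_eval, mul_add]

theorem hasHomologicalSolution_of_count_eq (ω : Fin n → ℝ) {S : Multiset (Fin n ⊕ Fin n)}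
    (hS : ∀ j, S.count (Sum.inl j) = S.count (Sum.inr j)) (c : ℂ) :
    HasHomologicalSolution ω S.card fun z => (c * complexMonomial S z).re := by
  let e : Fin n →₀ ℕ := Finsupp.equivFunOnFinite.symm fun j => S.count (Sum.inl j)
  have hactions (z : Phase n) :
      complexMonomial S z = ((∏ j, (2 * action j z) ^ S.count (Sum.inl j) : ℝ) : ℂ) := by
    rw [complexMonomial, prod_map_eq_prod_pow_count, Complex.ofReal_prod]
    refine Finset.prod_congr rfl fun j _ => ?_
    rw [← hS j, ← mul_pow, complexCoord_inl_mul_inr, Complex.ofReal_pow]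
  refine ⟨0, Submodule.zero_mem _,
    MvPolynomial.monomial e (c.re * ∏ j, 2 ^ S.count (Sum.inl j)), fun z => ?_⟩
  change (c * complexMonomial S z).re = _
  rw [hactions, Complex.re_mul_ofReal, actionEval, MvPolynomial.eval_monomial,
    Finsupp.prod_fintype _ _ fun j => pow_zero _]
  simp [e, mul_pow, Finset.prod_mul_distrib, mul_assoc]

theorem hasHomologicalSolution_of_sum_ne_zero {S : Multiset (Fin n ⊕ Fin n)}
    (hS : (S.map (harmonicEigenvalue ω)).sum ≠ 0) (c : ℂ) :
    HasHomologicalSolution ω S.card fun z => (c * complexMonomial S z).re := by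
  set μ := (S.map (harmonicEigenvalue ω)).sum with hμ
  refine ⟨_, re_mul_complexMonomial_mem_powerSpan S (c / μ), 0, fun z => ?_⟩
  have hG : HasFDerivAt (fun z => (c / μ * complexMonomial S z).re)
      (Complex.reCLM.comp ((c / μ) • fderiv ℝ (complexMonomial S) z)) z :=
    Complex.reCLM.hasFDerivAt.comp z ((differentiable_complexMonomial S z).hasFDerivAt.const_mul _)
  rw [hG.fderiv]
  simp only [ContinuousLinearMap.comp_apply, smul_apply, smul_eq_mul, Complex.reCLM_apply,
    fderiv_complexMonomial_hamVectorField_harmonic, ← hμ, actionEval, map_zero, add_zero]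
  rw [← mul_assoc, div_mul_cancel₀ c hS]

theorem NonResonantUpTo.hasHomologicalSolution_re_complexMonomial {S : Multiset (Fin n ⊕ Fin n)}
    (hω : NonResonantUpTo S.card ω) (c : ℂ) :
    HasHomologicalSolution ω S.card fun z => (c * complexMonomial S z).re := by
  let k : Fin n → ℤ := fun j => (S.count (Sum.inl j) : ℤ) - S.count (Sum.inr j)
  by_cases hk : k = 0
  · refine hasHomologicalSolution_of_count_eq ω (fun j => ?_) c
    exact Nat.cast_injective (sub_eq_zero.1 (congrFun hk j : k j = 0))
  · refine hasHomologicalSolution_of_sum_ne_zero ?_ c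
    have hkS : ∑ j, |k j| ≤ S.card := by
      rw [card_eq_sum_count]
      push_cast
      exact Finset.sum_le_sum fun j _ => abs_le.2 ⟨by simp only [k]; omega, by simp only [k]; omega⟩
    rw [sum_map_harmonicEigenvalue]
    exact mul_ne_zero (neg_ne_zero.2 Complex.I_ne_zero) (Complex.ofReal_ne_zero.2 (hω k hk hkS))

theorem NonResonantUpTo.hasHomologicalSolution (hω : NonResonantUpTo m ω)
    (hf : f ∈ powerSpan (Phase n) m) : HasHomologicalSolution ω m f := by
  replace hf : f ∈ reMonomialSpan n m := powerSpan_le_reMonomialSpan n m hf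
  induction hf using Submodule.span_induction with
  | mem f hf =>
    obtain ⟨S, c, rfl, rfl⟩ := hf
    exact hω.hasHomologicalSolution_re_complexMonomial c
  | zero => exact hasHomologicalSolution_zero ω m
  | add f g _ _ hf hg => exact hf.add hg
  | smul a f _ hf => exact hf.smul a

end Homological

section NearIdentity

variable {E F : Type*} [NormedAddCommGroup E] [NormedAddCommGroup F] {φ : E → E} {k m : ℕ}

theorem isBigO_norm_of_sub_isBigO (hk : 1 ≤ k)
    (hφ : (fun z => φ z - z) =O[𝓝 0] fun z => ‖z‖ ^ k) : φ =O[𝓝 0] fun z => ‖z‖ := by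
  have hsub := hφ.trans (isBigO_norm_pow_of_le hk)
  simp only [pow_one] at hsub
  exact (hsub.add (isBigO_refl (fun z : E => z) (𝓝 0)).norm_right).congr_left fun z => by simp

variable [NormedSpace ℝ E] [NormedSpace ℝ F] [CompleteSpace F] {f : E → F}

-- Mean value inequality on the ball of radius `(B + 1) ‖z‖`, which contains `z` and `φ z`.
theorem comp_sub_isBigO (hf : ContDiffAt ℝ (m + 1) f 0)
    (hfO : f =O[𝓝 0] fun z => ‖z‖ ^ (m + 1)) (hk : 1 ≤ k)
    (hφ : (fun z => φ z - z) =O[𝓝 0] fun z => ‖z‖ ^ k) :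
    (fun z => f (φ z) - f z) =O[𝓝 0] fun z => ‖z‖ ^ (m + k) := by
  obtain ⟨C, hC, hfderiv⟩ := (fderiv_isBigO hf hfO).exists_pos
  have hdiff : ∀ᶠ z in 𝓝 (0 : E), DifferentiableAt ℝ f z :=
    ((hf.of_le (m := 1) (by simp)).eventually (by simp)).mono
      fun z hz => hz.differentiableAt one_ne_zero
  obtain ⟨δ, hδ, hball⟩ := Metric.eventually_nhds_iff_ball.1 (hfderiv.bound.and hdiff)
  obtain ⟨B, hB, hφB⟩ := (isBigO_norm_of_sub_isBigO hk hφ).exists_pos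
  have hmean : (fun z => f (φ z) - f z) =O[𝓝 0] fun z => ‖z‖ ^ m * ‖φ z - z‖ := by
    refine IsBigO.of_bound (C * (B + 1) ^ m) ?_
    filter_upwards [hφB.bound, Metric.ball_mem_nhds 0 (show 0 < δ / (B + 1) by positivity)]
      with z hBz hz
    rw [norm_norm] at hBz
    rw [mem_ball_zero_iff, lt_div_iff₀ (by positivity)] at hz
    have hin : ∀ x ∈ Metric.closedBall (0 : E) ((B + 1) * ‖z‖), x ∈ Metric.ball 0 δ :=
      fun x hx => Metric.closedBall_subset_ball (by linarith) hx
    have hz' : z ∈ Metric.closedBall (0 : E) ((B + 1) * ‖z‖) :=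
      mem_closedBall_zero_iff.2 (by nlinarith [norm_nonneg z])
    have hφz : φ z ∈ Metric.closedBall (0 : E) ((B + 1) * ‖z‖) :=
      mem_closedBall_zero_iff.2 (by nlinarith [norm_nonneg z])
    have hbound : ∀ x ∈ Metric.closedBall (0 : E) ((B + 1) * ‖z‖),
        ‖fderiv ℝ f x‖ ≤ C * ((B + 1) * ‖z‖) ^ m := fun x hx => by
      refine (hball x (hin x hx)).1.trans ?_
      rw [norm_pow, norm_norm]
      gcongr
      exact mem_closedBall_zero_iff.1 hx
    refine ((convex_closedBall _ _).norm_image_sub_le_of_norm_fderiv_le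
      (fun x hx => (hball x (hin x hx)).2) hbound hz' hφz).trans_eq ?_
    rw [norm_mul, norm_norm, norm_pow, norm_norm, mul_pow]
    ring
  exact (hmean.trans ((isBigO_refl _ _).mul hφ.norm_left)).congr_right fun z => by ring

end NearIdentity

section Canonical

variable {n : ℕ}

/-- A linear map preserving the Poisson structure: `A J Aᵀ = J`, where `J` is the symplectic form
read as a map from covectors to vectors. -/
def IsPoissonMap (A : Phase n →L[ℝ] Phase n) : Prop :=
  ∀ β : Phase n →L[ℝ] ℝ, A (hamVector (β.comp A)) = hamVector β

theorem isPoissonMap_id : IsPoissonMap (ContinuousLinearMap.id ℝ (Phase n)) :=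
  fun _ => rfl

theorem IsPoissonMap.comp {A B : Phase n →L[ℝ] Phase n} (hA : IsPoissonMap A)
    (hB : IsPoissonMap B) : IsPoissonMap (A.comp B) := fun β => by
  rw [ContinuousLinearMap.comp_apply, ← ContinuousLinearMap.comp_assoc, hB, hA]

theorem isPoissonMap_transvection (ℓ : Phase n →L[ℝ] ℝ) (a : ℝ) :
    IsPoissonMap (ContinuousLinearMap.id ℝ (Phase n) + (a • ℓ).smulRight (hamVector ℓ)) := by
  intro β
  have hcomp : β.comp (ContinuousLinearMap.id ℝ (Phase n) + (a • ℓ).smulRight (hamVector ℓ))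
      = β + (a * β (hamVector ℓ)) • ℓ := by
    ext v
    simp only [ContinuousLinearMap.comp_apply, add_apply, ContinuousLinearMap.id_apply,
      ContinuousLinearMap.smulRight_apply, smul_apply, map_add, map_smul, smul_eq_mul]
    ring
  simp only [hcomp, map_add, map_smul, add_apply, ContinuousLinearMap.id_apply,
    ContinuousLinearMap.smulRight_apply, smul_apply, smul_eq_mul, apply_hamVector_self,
    apply_hamVector ℓ β]
  module

/-- A real analytic symplectic diffeomorphism of the whole phase space which agrees with the
identity up to second order at the origin. -/
structure IsGlobalCanonical (e : Phase n ≃ₜ Phase n) : Prop where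
  analytic : AnalyticOnNhd ℝ e Set.univ
  analytic_symm : AnalyticOnNhd ℝ e.symm Set.univ
  isPoissonMap_fderiv : ∀ z, IsPoissonMap (fderiv ℝ e z)
  near_id : (fun z => e z - z) =O[𝓝 0] fun z => ‖z‖ ^ 2

namespace IsGlobalCanonical

variable {e e' : Phase n ≃ₜ Phase n}

theorem refl : IsGlobalCanonical (Homeomorph.refl (Phase n)) where
  analytic := analyticOnNhd_id
  analytic_symm := analyticOnNhd_id
  isPoissonMap_fderiv z := by
    have hid : fderiv ℝ (Homeomorph.refl (Phase n)) z = ContinuousLinearMap.id ℝ (Phase n) :=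
      fderiv_id
    exact hid ▸ isPoissonMap_id
  near_id := by simpa using isBigO_zero _ _

theorem map_zero (he : IsGlobalCanonical e) : e 0 = 0 := by
  have h : (fun z => e z - z) =O[𝓝 0] fun z : Phase n => ‖z - 0‖ ^ 2 := by
    simpa using he.near_id
  simpa using h.eq_zero_of_norm_pow two_ne_zero

theorem contDiff (he : IsGlobalCanonical e) {k : WithTop ℕ∞} : ContDiff ℝ k e :=
  contDiffOn_univ.1 (he.analytic.contDiffOn uniqueDiffOn_univ)

theorem contDiff_symm (he : IsGlobalCanonical e) {k : WithTop ℕ∞} : ContDiff ℝ k e.symm :=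
  contDiffOn_univ.1 (he.analytic_symm.contDiffOn uniqueDiffOn_univ)

theorem tendsto_zero (he : IsGlobalCanonical e) : Tendsto e (𝓝 0) (𝓝 0) := by
  simpa only [he.map_zero] using e.continuous.tendsto 0

theorem trans (he : IsGlobalCanonical e) (he' : IsGlobalCanonical e') :
    IsGlobalCanonical (e.trans e') where
  analytic := he'.analytic.comp he.analytic (Set.mapsTo_univ _ _)
  analytic_symm := he.analytic_symm.comp he'.analytic_symm (Set.mapsTo_univ _ _)
  isPoissonMap_fderiv z := by
    have hcomp : fderiv ℝ (e.trans e') z = (fderiv ℝ e' (e z)).comp (fderiv ℝ e z) :=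
      fderiv_comp z (he'.contDiff.differentiable one_ne_zero _)
        (he.contDiff.differentiable one_ne_zero _)
    exact hcomp ▸ (he'.isPoissonMap_fderiv _).comp (he.isPoissonMap_fderiv z)
  near_id := by
    have h := (he'.near_id.comp_tendsto he.tendsto_zero).trans
      ((isBigO_norm_of_sub_isBigO one_le_two he.near_id).norm_left.pow 2)
    exact (h.add he.near_id).congr_left fun z => by simp

theorem contDiffAt_comp (he : IsGlobalCanonical e) {f : Phase n → ℝ} {k : WithTop ℕ∞}
    (hf : ContDiffAt ℝ k f 0) : ContDiffAt ℝ k (f ∘ e) 0 :=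
  ContDiffAt.comp 0 (he.map_zero.symm ▸ hf) he.contDiff.contDiffAt

end IsGlobalCanonical

/-- The shear `z ↦ z + c ℓ(z) ^ k J ℓ`. It is the flow at time `c` of the Hamiltonian
`ℓ ^ (k + 1) / (k + 1)`, because `ℓ` is constant along that flow. -/
noncomputable def shear (ℓ : Phase n →L[ℝ] ℝ) (c : ℝ) (k : ℕ) (z : Phase n) : Phase n :=
  z + (c * ℓ z ^ k) • hamVector ℓ

theorem apply_shear (ℓ : Phase n →L[ℝ] ℝ) (c : ℝ) (k : ℕ) (z : Phase n) :
    ℓ (shear ℓ c k z) = ℓ z := by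
  simp [shear, apply_hamVector_self]

theorem shear_neg_shear (ℓ : Phase n →L[ℝ] ℝ) (c : ℝ) (k : ℕ) (z : Phase n) :
    shear ℓ (-c) k (shear ℓ c k z) = z := by
  rw [shear, apply_shear, shear]
  module

theorem analyticOnNhd_shear (ℓ : Phase n →L[ℝ] ℝ) (c : ℝ) (k : ℕ) :
    AnalyticOnNhd ℝ (shear ℓ c k) Set.univ := fun z _ =>
  analyticAt_id.add ((analyticAt_const.mul ((ℓ.analyticAt z).pow k)).smul analyticAt_const)

/-- The shear `shear ℓ c k` as a homeomorphism, with inverse `shear ℓ (-c) k`. -/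
noncomputable def shearHomeomorph (ℓ : Phase n →L[ℝ] ℝ) (c : ℝ) (k : ℕ) : Phase n ≃ₜ Phase n where
  toFun := shear ℓ c k
  invFun := shear ℓ (-c) k
  left_inv := shear_neg_shear ℓ c k
  right_inv z := by simpa using shear_neg_shear ℓ (-c) k z
  continuous_toFun := continuousOn_univ.1 (analyticOnNhd_shear ℓ c k).continuousOn
  continuous_invFun := continuousOn_univ.1 (analyticOnNhd_shear ℓ (-c) k).continuousOn

theorem const_mul_apply_pow_isBigO (ℓ : Phase n →L[ℝ] ℝ) (c : ℝ) (k : ℕ) :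
    (fun z => c * ℓ z ^ k) =O[𝓝 0] fun z => ‖z‖ ^ k :=
  ((ℓ.isBigO_id _).norm_right.pow k).const_mul_left c

theorem shear_sub_isBigO (ℓ : Phase n →L[ℝ] ℝ) (c : ℝ) (k : ℕ) :
    (fun z => shear ℓ c k z - z) =O[𝓝 0] fun z => ‖z‖ ^ k := by
  simpa [shear] using (const_mul_apply_pow_isBigO ℓ c k).smul
    (isBigO_const_const (hamVector ℓ) (one_ne_zero (α := ℝ)) _)

theorem isGlobalCanonical_shear (ℓ : Phase n →L[ℝ] ℝ) (c : ℝ) {k : ℕ} (hk : 2 ≤ k) :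
    IsGlobalCanonical (shearHomeomorph ℓ c k) where
  analytic := analyticOnNhd_shear ℓ c k
  analytic_symm := analyticOnNhd_shear ℓ (-c) k
  isPoissonMap_fderiv z := by
    have h : HasFDerivAt (shear ℓ c k) (ContinuousLinearMap.id ℝ (Phase n)
        + ((c * (k * ℓ z ^ (k - 1))) • ℓ).smulRight (hamVector ℓ)) z := by
      refine ((hasFDerivAt_id z).add
        (((ℓ.hasFDerivAt.pow k).const_mul c).smul_const (hamVector ℓ))).congr_fderiv ?_
      ext v
      simp only [nsmul_eq_mul, add_apply, ContinuousLinearMap.id_apply,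
        ContinuousLinearMap.smulRight_apply, smul_apply, smul_eq_mul, PiLp.add_apply,
        PiLp.smul_apply]
      ring
    have hfderiv : fderiv ℝ (shearHomeomorph ℓ c k) z = _ := h.fderiv
    exact hfderiv ▸ isPoissonMap_transvection _ _
  near_id := (shear_sub_isBigO ℓ c k).trans (isBigO_norm_pow_of_le hk)

end Canonical

section Normalization

variable {n : ℕ} {ω : Fin n → ℝ} {m k : ℕ} {f : Phase n → ℝ}

theorem harmonic_isBigO (ω : Fin n → ℝ) (l : Filter (Phase n)) :
    harmonic ω =O[l] fun z => ‖z‖ ^ 2 :=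
  IsBigO.fun_sum fun j _ => (action_isBigO j l).const_mul_left (ω j)

theorem harmonic_add (ω : Fin n → ℝ) (z v : Phase n) :
    harmonic ω (z + v) = harmonic ω z + fderiv ℝ (harmonic ω) z v + harmonic ω v := by
  simp only [fderiv_harmonic_apply, fderiv_action_apply, harmonic, ← Finset.sum_add_distrib]
  refine Finset.sum_congr rfl fun j _ => ?_
  simp only [action, PiLp.add_apply]
  ring

theorem harmonic_add_smul_hamVector (ω : Fin n → ℝ) (ℓ : Phase n →L[ℝ] ℝ) (a : ℝ) (z : Phase n) :
    harmonic ω (z + a • hamVector ℓ) = harmonic ω z - a * ℓ (hamVectorField (harmonic ω) z)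
      + a ^ 2 * harmonic ω (hamVector ℓ) := by
  have hsq : harmonic ω (a • hamVector ℓ) = a ^ 2 * harmonic ω (hamVector ℓ) := by
    simp only [harmonic, action, PiLp.smul_apply, smul_eq_mul, Finset.mul_sum]
    exact Finset.sum_congr rfl fun j _ => by ring
  rw [harmonic_add, hsq, map_smul, apply_hamVector, hamVectorField_eq, smul_eq_mul,
    Function.comp_apply]
  ring

theorem fderiv_hamVectorField_harmonic_isBigO (ω : Fin n → ℝ) {G : Phase n → ℝ}
    (hG : G ∈ powerSpan (Phase n) (m + 1)) :
    (fun z => fderiv ℝ G z (hamVectorField (harmonic ω) z)) =O[𝓝 0] fun z => ‖z‖ ^ (m + 1) := by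
  have hdG : fderiv ℝ G =O[𝓝 0] fun z => ‖z‖ ^ m :=
    fderiv_isBigO (contDiff_of_mem_powerSpan hG).contDiffAt (isBigO_of_mem_powerSpan hG _)
  have hX : hamVectorField (harmonic ω) =O[𝓝 0] fun z => ‖z‖ ^ 1 :=
    (hamVector.isBigO_comp _ _).trans
      (fderiv_isBigO (contDiff_harmonic ω).contDiffAt (harmonic_isBigO ω _))
  have happly : (fun z => fderiv ℝ G z (hamVectorField (harmonic ω) z)) =O[𝓝 0]
      fun z => ‖fderiv ℝ G z‖ * ‖hamVectorField (harmonic ω) z‖ :=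
    IsBigO.of_bound' (Eventually.of_forall fun z => by
      simpa using (fderiv ℝ G z).le_opNorm (hamVectorField (harmonic ω) z))
  exact (happly.trans (hdG.norm_left.mul hX.norm_left)).congr_right fun z => (pow_add _ m 1).symm

/-- `φ` acts on Hamiltonians `f` with quadratic part `H₀` like the flow of `G` to first order:
`f ∘ φ - f = -{G, H₀}` up to terms of order `m + 1`, where `m` is the degree of `G`. -/
def IsGeneratedBy (ω : Fin n → ℝ) (m : ℕ) (G : Phase n → ℝ) (φ : Phase n → Phase n) : Prop :=
  ∀ f : Phase n → ℝ, ContDiffAt ℝ 3 f 0 →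
    (f - harmonic ω) =O[𝓝 0] (fun z => ‖z‖ ^ 3) →
    (f ∘ φ - f + fun z => fderiv ℝ G z (hamVectorField (harmonic ω) z))
      =O[𝓝 0] fun z => ‖z‖ ^ (m + 1)

theorem IsGeneratedBy.comp_sub_harmonic_isBigO {G : Phase n → ℝ} {φ : Phase n → Phase n}
    (hφ : IsGeneratedBy ω m G φ) (hG : G ∈ powerSpan (Phase n) m) (hm : 3 ≤ m)
    (hf : ContDiffAt ℝ 3 f 0) (hfO : (f - harmonic ω) =O[𝓝 0] (fun z => ‖z‖ ^ 3)) :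
    (f ∘ φ - harmonic ω) =O[𝓝 0] fun z => ‖z‖ ^ 3 := by
  obtain ⟨k, rfl⟩ : ∃ k, m = k + 1 := ⟨m - 1, by omega⟩
  have hremainder := (hφ f hf hfO).trans (isBigO_norm_pow_of_le (show 3 ≤ k + 1 + 1 by omega))
  have hbracket := (fderiv_hamVectorField_harmonic_isBigO ω hG).trans (isBigO_norm_pow_of_le hm)
  exact ((hremainder.sub hbracket).add hfO).congr_left fun z => by simp

theorem isGeneratedBy_shear (ω : Fin n → ℝ) (ℓ : Phase n →L[ℝ] ℝ) (c : ℝ) (hk : 2 ≤ k) :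
    IsGeneratedBy ω (k + 1) (c • fun z => ℓ z ^ (k + 1))
      (shearHomeomorph ℓ (c * (k + 1)) k) := by
  intro f hf hfO
  have hfderiv (z : Phase n) : fderiv ℝ (c • fun z => ℓ z ^ (k + 1)) z
      = (c * (k + 1) * ℓ z ^ k) • ℓ := by
    refine ((ℓ.hasFDerivAt.pow (k + 1)).const_smul c).fderiv.trans ?_
    ext v
    simp only [add_tsub_cancel_right, nsmul_eq_mul, Nat.cast_add, Nat.cast_one, smul_apply,
      smul_eq_mul]
    ring
  have hcubic : (fun z => (f - harmonic ω) (shear ℓ (c * (k + 1)) k z) - (f - harmonic ω) z)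
      =O[𝓝 0] fun z => ‖z‖ ^ (k + 1 + 1) := by
    have h := comp_sub_isBigO (m := 2) (hf.sub (contDiff_harmonic ω).contDiffAt) hfO (by omega)
      (shear_sub_isBigO ℓ (c * (k + 1)) k)
    rwa [show 2 + k = k + 1 + 1 by omega] at h
  have hquadratic : (fun z => (c * (k + 1) * ℓ z ^ k) ^ 2 * harmonic ω (hamVector ℓ))
      =O[𝓝 0] fun z => ‖z‖ ^ (k + 1 + 1) := by
    simp only [mul_comm _ (harmonic ω (hamVector ℓ))]
    refine (((const_mul_apply_pow_isBigO ℓ (c * (k + 1)) k).pow 2).const_mul_left _).trans ?_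
    simpa only [← pow_mul] using isBigO_norm_pow_of_le (show k + 1 + 1 ≤ k * 2 by omega)
  refine (hcubic.add hquadratic).congr_left fun z => ?_
  have hshear : shearHomeomorph ℓ (c * (k + 1)) k z = shear ℓ (c * (k + 1)) k z := rfl
  simp only [Pi.add_apply, Pi.sub_apply, Function.comp_apply, hfderiv, hshear]
  rw [shear, harmonic_add_smul_hamVector]
  simp only [smul_apply, smul_eq_mul]
  ring

theorem exists_isGlobalCanonical_isGeneratedBy (ω : Fin n → ℝ) (hm : 3 ≤ m) {G : Phase n → ℝ}
    (hG : G ∈ powerSpan (Phase n) m) :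
    ∃ e : Phase n ≃ₜ Phase n, IsGlobalCanonical e ∧ IsGeneratedBy ω m G e := by
  induction hG using Submodule.closure_induction with
  | zero =>
    exact ⟨Homeomorph.refl _, .refl, fun f _ _ => (isBigO_zero _ _).congr_left fun z => by simp⟩
  | add G₁ G₂ hG₁ hG₂ h₁ h₂ =>
    obtain ⟨e₁, he₁, h₁⟩ := h₁
    obtain ⟨e₂, he₂, h₂⟩ := h₂
    refine ⟨e₂.trans e₁, he₂.trans he₁, fun f hf hfO => ?_⟩
    have hcomp := h₂ (f ∘ e₁) (he₁.contDiffAt_comp hf)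
      (h₁.comp_sub_harmonic_isBigO hG₁ hm hf hfO)
    refine ((h₁ f hf hfO).add hcomp).congr_left fun z => ?_
    simp only [Pi.add_apply, Pi.sub_apply, Function.comp_apply, Homeomorph.trans_apply]
    rw [fderiv_add ((contDiff_of_mem_powerSpan hG₁ (k := 1)).differentiable one_ne_zero z)
      ((contDiff_of_mem_powerSpan hG₂ (k := 1)).differentiable one_ne_zero z), add_apply]
    ring
  | smul_mem c G hG =>
    obtain ⟨ℓ, rfl⟩ := hG
    obtain ⟨k, rfl⟩ : ∃ k, m = k + 1 := ⟨m - 1, by omega⟩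
    exact ⟨_, isGlobalCanonical_shear ℓ _ (by omega), isGeneratedBy_shear ω ℓ c (by omega)⟩

theorem exists_isGlobalCanonical_comp_sub_actionEval_isBigO {N : ℕ} (hN : 2 ≤ N)
    (hω : NonResonantUpTo N ω) {H : Phase n → ℝ} (hH : ContDiffAt ℝ (N + 1) H 0)
    (hHO : (H - harmonic ω) =O[𝓝 0] fun z => ‖z‖ ^ 3) :
    ∃ e : Phase n ≃ₜ Phase n, IsGlobalCanonical e ∧
      (H ∘ e - harmonic ω) =O[𝓝 0] (fun z => ‖z‖ ^ 3) ∧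
      ∃ Z : MvPolynomial (Fin n) ℝ,
        (H ∘ e - (harmonic ω + actionEval Z)) =O[𝓝 0] fun z => ‖z‖ ^ (N + 1) := by
  induction N, hN using Nat.le_induction with
  | base =>
    refine ⟨Homeomorph.refl _, .refl, hHO, 0, hHO.congr_left fun z => ?_⟩
    simp [actionEval]
  | succ N hN ih =>
    have hle : ((N : ℕ) + 1 : WithTop ℕ∞) ≤ ((N + 1 : ℕ) : WithTop ℕ∞) + 1 := by norm_cast; omega
    obtain ⟨e, he, heO, Z, hZ⟩ := ih (hω.mono N.le_succ) (hH.of_le hle)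
    have hHe : ContDiffAt ℝ ((N + 1 : ℕ) + 1) (H ∘ e) 0 := he.contDiffAt_comp hH
    set R := H ∘ e - (harmonic ω + actionEval Z)
    have hR : ContDiffAt ℝ ((N + 1 : ℕ) + 1) R 0 :=
      hHe.sub ((contDiff_harmonic ω).add (contDiff_actionEval Z)).contDiffAt
    obtain ⟨G, hG, Z', hsol⟩ := hω.hasHomologicalSolution (taylorPart_mem_powerSpan R (N + 1))
    obtain ⟨σ, hσ, hσG⟩ := exists_isGlobalCanonical_isGeneratedBy ω (by omega) hG
    have hHe3 : ContDiffAt ℝ 3 (H ∘ e) 0 := hHe.of_le (by norm_cast; omega)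
    refine ⟨σ.trans e, hσ.trans he, hσG.comp_sub_harmonic_isBigO hG (by omega) hHe3 heO,
      Z + Z', ?_⟩
    refine ((hσG _ hHe3 heO).add (sub_taylorPart_isBigO hR hZ)).congr_left fun z => ?_
    simp only [R, Pi.add_apply, Pi.sub_apply, Function.comp_apply, Homeomorph.trans_apply,
      actionEval_add, hsol z]
    ring

end Normalization

section Torus

variable {n : ℕ}

theorem exists_sq_add_sq_eq_sq (q p ρ : ℝ) : ∃ a b : ℝ, b ^ 2 + a ^ 2 = ρ ^ 2 ∧
    (q - a) ^ 2 + (p - b) ^ 2 = (√(p ^ 2 + q ^ 2) - ρ) ^ 2 := by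
  set c : ℂ := ⟨q, p⟩
  have hq : q = ‖c‖ * Real.cos c.arg := (Complex.norm_mul_cos_arg c).symm
  have hp : p = ‖c‖ * Real.sin c.arg := (Complex.norm_mul_sin_arg c).symm
  have hc : √(p ^ 2 + q ^ 2) = ‖c‖ := by rw [Complex.norm_eq_sqrt_sq_add_sq, add_comm]
  have hone := Real.sin_sq_add_cos_sq c.arg
  refine ⟨ρ * Real.cos c.arg, ρ * Real.sin c.arg, ?_, ?_⟩
  · linear_combination ρ ^ 2 * hone
  · rw [hc, hq, hp]
    linear_combination (‖c‖ - ρ) ^ 2 * hone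

theorem exists_mem_actionTorus_norm_sub_le (w w₀ : Phase n) :
    ∃ x ∈ actionTorus (fun j => action j w₀),
      ‖w - x‖ ≤ ∑ j, |√(2 * action j w) - √(2 * action j w₀)| := by
  choose a b hab hdist using fun j =>
    exists_sq_add_sq_eq_sq (w (Sum.inl j)) (w (Sum.inr j)) (√(2 * action j w₀))
  refine ⟨WithLp.toLp 2 (Sum.elim a b), fun j => ?_, ?_⟩
  · have h := hab j
    rw [Real.sq_sqrt (mul_nonneg zero_le_two (action_nonneg _ _))] at h
    change (b j ^ 2 + a j ^ 2) / 2 = action j w₀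
    linarith
  · have hnonneg : ∀ j ∈ Finset.univ, 0 ≤ |√(2 * action j w) - √(2 * action j w₀)| :=
      fun _ _ => abs_nonneg _
    refine (sq_le_sq₀ (norm_nonneg _) (Finset.sum_nonneg hnonneg)).1 ?_
    refine le_of_eq_of_le ?_ (Finset.sum_sq_le_sq_sum_of_nonneg hnonneg)
    rw [EuclideanSpace.real_norm_sq_eq, Fintype.sum_sum_type, ← Finset.sum_add_distrib]
    refine Finset.sum_congr rfl fun j _ => ?_
    rw [sq_abs, show 2 * action j w = w (Sum.inr j) ^ 2 + w (Sum.inl j) ^ 2 by rw [action]; ring,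
      ← hdist j]
    simp

theorem norm_eq_of_mem_actionTorus {w x : Phase n}
    (hx : x ∈ actionTorus (fun j => action j w)) : ‖x‖ = ‖w‖ := by
  refine (pow_left_inj₀ (norm_nonneg _) (norm_nonneg _) two_ne_zero).1 ?_
  rw [norm_sq_eq_sum_action, norm_sq_eq_sum_action]
  exact Finset.sum_congr rfl fun j _ => by rw [hx j]

end Torus

section Drift

variable {n : ℕ} {J : Set ℝ} {B s t : ℝ}

-- `√u` need not be differentiable where `u` vanishes, so we differentiate `√(u + η)` and let
-- `η → 0`.
theorem abs_sqrt_sub_sqrt_le {u u' : ℝ → ℝ} (hJ : J.OrdConnected)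
    (hu : ∀ x ∈ J, HasDerivWithinAt u (u' x) J x) (hu0 : ∀ x ∈ J, 0 ≤ u x) (hB : 0 ≤ B)
    (hu' : ∀ x ∈ J, |u' x| ≤ 2 * B * √(u x)) (hs : s ∈ J) (ht : t ∈ J) :
    |√(u t) - √(u s)| ≤ B * |t - s| := by
  have hη : ∀ η > 0, |√(u t + η) - √(u s + η)| ≤ B * |t - s| := by
    intro η hη
    refine hJ.convex.norm_image_sub_le_of_norm_hasDerivWithin_le (f := fun x => √(u x + η))
      (fun x hx => ((hu x hx).add_const η).sqrt (by have := hu0 x hx; positivity))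
      (fun x hx => ?_) hs ht
    have hpos : 0 < √(u x + η) := Real.sqrt_pos.2 (by have := hu0 x hx; positivity)
    rw [Real.norm_eq_abs, abs_div, abs_of_pos (show 0 < 2 * √(u x + η) by positivity),
      div_le_iff₀ (by positivity)]
    calc |u' x| ≤ 2 * B * √(u x) := hu' x hx
      _ ≤ 2 * B * √(u x + η) := by gcongr; linarith
      _ = B * (2 * √(u x + η)) := by ring
  have hcont : Continuous fun η : ℝ => |√(u t + η) - √(u s + η)| := by fun_prop
  have hlim := (hcont.tendsto 0).mono_left (nhdsWithin_le_nhds (s := Set.Ioi 0))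
  simp only [add_zero] at hlim
  exact le_of_tendsto hlim (eventually_mem_nhdsWithin.mono hη)

theorem abs_sqrt_action_sub_le {w v : ℝ → Phase n} {j : Fin n} (hJ : J.OrdConnected)
    (hw : ∀ x ∈ J, HasDerivWithinAt w (v x) J x) (hB : 0 ≤ B)
    (hv : ∀ x ∈ J, |fderiv ℝ (action j) (w x) (v x)| ≤ B * √(2 * action j (w x)))
    (hs : s ∈ J) (ht : t ∈ J) :
    |√(2 * action j (w t)) - √(2 * action j (w s))| ≤ B * |t - s| := by
  refine abs_sqrt_sub_sqrt_le (u := fun x => 2 * action j (w x)) hJ (fun x hx =>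
    (((hasFDerivAt_action j _).differentiableAt.hasFDerivAt.comp_hasDerivWithinAt x
      (hw x hx)).const_mul 2)) (fun x _ => mul_nonneg zero_le_two (action_nonneg _ _)) hB
    (fun x hx => ?_) hs ht
  rw [abs_mul, abs_two, mul_assoc]
  exact mul_le_mul_of_nonneg_left (hv x hx) zero_le_two

theorem abs_fderiv_action_hamVectorField_le {F : Phase n → ℝ} {z : Phase n}
    (hF : DifferentiableAt ℝ F z) (Φ : MvPolynomial (Fin n) ℝ) (j : Fin n) :
    |fderiv ℝ (action j) z (hamVectorField F z)|
      ≤ √(2 * action j z) * ‖hamVectorField (F - actionEval Φ) z‖ := by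
  have hΦ : DifferentiableAt ℝ (actionEval Φ) z :=
    (contDiff_actionEval Φ (k := 1)).differentiable one_ne_zero z
  have hsplit : hamVectorField (F - actionEval Φ) z
      = hamVectorField F z - hamVectorField (actionEval Φ) z := by
    simp only [hamVectorField_eq, Function.comp_apply, fderiv_sub hF hΦ, map_sub]
  have heq : fderiv ℝ (action j) z (hamVectorField F z)
      = fderiv ℝ (action j) z (hamVectorField (F - actionEval Φ) z) := by
    rw [hsplit, map_sub, fderiv_action_hamVectorField_actionEval, sub_zero]
  exact heq ▸ abs_fderiv_action_le j z _

theorem exists_mem_actionTorus_norm_sub_le_mul_abs {F : Phase n → ℝ}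
    {Φ : MvPolynomial (Fin n) ℝ} {w : ℝ → Phase n} (hJ : J.OrdConnected)
    (hw : ∀ x ∈ J, HasDerivWithinAt w (hamVectorField F (w x)) J x)
    (hF : ∀ x ∈ J, DifferentiableAt ℝ F (w x))
    (hB : ∀ x ∈ J, ‖hamVectorField (F - actionEval Φ) (w x)‖ ≤ B) (hs : s ∈ J) (ht : t ∈ J) :
    ∃ x ∈ actionTorus (fun j => action j (w s)), ‖w t - x‖ ≤ n * B * |t - s| := by
  obtain ⟨x, hx, hle⟩ := exists_mem_actionTorus_norm_sub_le (w t) (w s)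
  refine ⟨x, hx, hle.trans ?_⟩
  have hdrift (j : Fin n) : |√(2 * action j (w t)) - √(2 * action j (w s))| ≤ B * |t - s| := by
    refine abs_sqrt_action_sub_le hJ hw ((norm_nonneg _).trans (hB s hs)) (fun x hx => ?_) hs ht
    refine (abs_fderiv_action_hamVectorField_le (hF x hx) Φ j).trans ?_
    rw [mul_comm B]
    exact mul_le_mul_of_nonneg_left (hB x hx) (Real.sqrt_nonneg _)
  calc _ ≤ ∑ _j : Fin n, B * |t - s| := Finset.sum_le_sum fun j _ => hdrift j
    _ = n * B * |t - s| := by simp [mul_assoc]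

end Drift

section Confinement

variable {n : ℕ} {t : ℝ}

theorem exists_first_hit {g : ℝ → ℝ} {a : ℝ} (hg : ContinuousOn g (Set.uIcc 0 t)) (h0 : g 0 < a)
    (ht : a ≤ g t) : ∃ s ∈ Set.uIcc 0 t, g s = a ∧ ∀ x ∈ Set.uIcc 0 s, g x ≤ a := by
  have hivt : ∀ x ∈ Set.uIcc 0 t, a ≤ g x → ∃ y ∈ Set.uIcc 0 x, g y = a := fun x hx hax =>
    intermediate_value_uIcc (hg.mono (Set.uIcc_subset_uIcc_left hx))
      (Set.mem_uIcc.2 (Or.inl ⟨h0.le, hax⟩))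
  have hcompact : IsCompact (Set.uIcc 0 t ∩ g ⁻¹' {a}) :=
    isCompact_uIcc.of_isClosed_subset
      (hg.preimage_isClosed_of_isClosed isCompact_uIcc.isClosed isClosed_singleton)
      Set.inter_subset_left
  obtain ⟨y, hy, hya⟩ := hivt t Set.right_mem_uIcc ht
  obtain ⟨s, ⟨hs, hsa⟩, hmin⟩ :=
    hcompact.exists_isMinOn ⟨y, hy, hya⟩ continuous_abs.continuousOn
  refine ⟨s, hs, hsa, fun x hx => ?_⟩
  by_contra! hlt
  have hxt := Set.uIcc_subset_uIcc_left hs hx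
  obtain ⟨y, hy, hya⟩ := hivt x hxt hlt.le
  have hsy : |s| ≤ |y| := hmin ⟨Set.uIcc_subset_uIcc_left hxt hy, hya⟩
  have hxs : x = s := by
    rw [Set.mem_uIcc] at hx hy
    grind
  exact hlt.ne' (hxs ▸ hsa)

-- A bootstrap: up to the first time `w` reaches the sphere of radius `2 η`, it is at distance less
-- than `η` from a torus inside the ball of radius `η`.
theorem norm_lt_two_mul_of_drift_lt {F : Phase n → ℝ} {Φ : MvPolynomial (Fin n) ℝ} {B η : ℝ}
    {w : ℝ → Phase n} (hF : ∀ z, ‖z‖ ≤ 2 * η → DifferentiableAt ℝ F z)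
    (hB : ∀ z, ‖z‖ ≤ 2 * η → ‖hamVectorField (F - actionEval Φ) z‖ ≤ B)
    (hc : ContinuousOn w (Set.uIcc 0 t)) (h0 : ‖w 0‖ ≤ η)
    (hw : ∀ s ∈ Set.uIcc 0 t, ‖w s‖ ≤ 2 * η →
      HasDerivWithinAt w (hamVectorField F (w s)) (Set.uIcc 0 t) s)
    (hdrift : n * B * |t| < η) : ‖w t‖ < 2 * η := by
  by_contra! hle
  have hη : 0 ≤ η := (norm_nonneg _).trans h0
  have hB0 : 0 ≤ B := (norm_nonneg _).trans (hB 0 (by rw [norm_zero]; linarith))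
  have hη0 : 0 < η := lt_of_le_of_lt (by positivity) hdrift
  obtain ⟨s, hs, hsη, hsle⟩ := exists_first_hit hc.norm (by linarith) hle
  have hsub : Set.uIcc 0 s ⊆ Set.uIcc 0 t := Set.uIcc_subset_uIcc_left hs
  obtain ⟨x, hx, hxw⟩ := exists_mem_actionTorus_norm_sub_le_mul_abs Set.ordConnected_uIcc
    (fun y hy => (hw y (hsub hy) (hsle y hy)).mono hsub) (fun y hy => hF _ (hsle y hy))
    (fun y hy => hB _ (hsle y hy)) Set.left_mem_uIcc Set.right_mem_uIcc
  have hst : |s - 0| ≤ |t| := by simpa using Set.abs_sub_left_of_mem_uIcc hs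
  have hdrift_le : n * B * |s - 0| ≤ n * B * |t| :=
    mul_le_mul_of_nonneg_left hst (by positivity)
  have htriangle : ‖w s‖ ≤ ‖w s - x‖ + ‖x‖ := by simpa using norm_add_le (w s - x) x
  rw [norm_eq_of_mem_actionTorus hx] at htriangle
  linarith

theorem exists_mem_actionTorus_of_drift_lt {F : Phase n → ℝ} {Φ : MvPolynomial (Fin n) ℝ}
    {B η : ℝ} {w : ℝ → Phase n} (hF : ∀ z, ‖z‖ ≤ 2 * η → DifferentiableAt ℝ F z)
    (hB : ∀ z, ‖z‖ ≤ 2 * η → ‖hamVectorField (F - actionEval Φ) z‖ ≤ B)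
    (hc : ContinuousOn w (Set.uIcc 0 t)) (h0 : ‖w 0‖ ≤ η)
    (hw : ∀ s ∈ Set.uIcc 0 t, ‖w s‖ ≤ 2 * η →
      HasDerivWithinAt w (hamVectorField F (w s)) (Set.uIcc 0 t) s)
    (hdrift : n * B * |t| < η) :
    ∃ x ∈ actionTorus (fun j => action j (w 0)), ‖w t - x‖ ≤ n * B * |t| := by
  have hη : 0 ≤ η := (norm_nonneg _).trans h0
  have hB0 : 0 ≤ B := (norm_nonneg _).trans (hB 0 (by rw [norm_zero]; linarith))
  have hle : ∀ s ∈ Set.uIcc 0 t, ‖w s‖ ≤ 2 * η := fun s hs => by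
    have hsub : Set.uIcc 0 s ⊆ Set.uIcc 0 t := Set.uIcc_subset_uIcc_left hs
    have hst : |s| ≤ |t| := by simpa using Set.abs_sub_left_of_mem_uIcc hs
    exact (norm_lt_two_mul_of_drift_lt hF hB (hc.mono hsub) h0
      (fun y hy hyle => (hw y (hsub hy) hyle).mono hsub)
      (lt_of_le_of_lt (by gcongr) hdrift)).le
  simpa using exists_mem_actionTorus_norm_sub_le_mul_abs Set.ordConnected_uIcc
    (fun s hs => hw s hs (hle s hs)) (fun s hs => hF _ (hle s hs)) (fun s hs => hB _ (hle s hs))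
    Set.left_mem_uIcc (Set.right_mem_uIcc (a := 0))

end Confinement

theorem eventually_forall_norm_le {E : Type*} [SeminormedAddCommGroup E] {p : E → Prop}
    (hp : ∀ᶠ x in 𝓝 0, p x) : ∀ᶠ δ in 𝓝[>] (0 : ℝ), ∀ x, ‖x‖ ≤ δ → p x := by
  obtain ⟨δ, hδ, hball⟩ := Metric.eventually_nhds_iff_ball.1 hp
  filter_upwards [Ioo_mem_nhdsGT hδ] with δ' hδ' x hx
  exact hball x (mem_ball_zero_iff.2 (hx.trans_lt hδ'.2))

section Transport

variable {n : ℕ} {e : Phase n ≃ₜ Phase n} {H : Phase n → ℝ}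

namespace IsGlobalCanonical

theorem fderiv_hamVectorField_comp (he : IsGlobalCanonical e) {w : Phase n}
    (hH : DifferentiableAt ℝ H (e w)) :
    fderiv ℝ e w (hamVectorField (H ∘ e) w) = hamVectorField H (e w) := by
  simp only [hamVectorField_eq, Function.comp_apply]
  rw [fderiv_comp w hH (he.contDiff.differentiable one_ne_zero w)]
  exact he.isPoissonMap_fderiv w _

theorem hasDerivWithinAt_symm_comp (he : IsGlobalCanonical e) {J : Set ℝ} {t : ℝ}
    {z : ℝ → Phase n} (hH : DifferentiableAt ℝ H (z t))
    (hz : HasDerivWithinAt z (hamVectorField H (z t)) J t) :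
    HasDerivWithinAt (e.symm ∘ z) (hamVectorField (H ∘ e) (e.symm (z t))) J t := by
  set w := e.symm (z t)
  have hzw : z t = e w := (e.apply_symm_apply _).symm
  have hinv : HasFDerivAt (e.symm ∘ e) ((fderiv ℝ e.symm (e w)).comp (fderiv ℝ e w)) w :=
    (he.contDiff_symm.differentiable one_ne_zero _).hasFDerivAt.comp w
      (he.contDiff.differentiable one_ne_zero w).hasFDerivAt
  rw [e.symm_comp_self] at hinv
  have hid := congrArg (fun A : Phase n →L[ℝ] Phase n => A (hamVectorField (H ∘ e) w))
    (hinv.unique (hasFDerivAt_id w))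
  simp only [ContinuousLinearMap.comp_apply, ContinuousLinearMap.id_apply,
    he.fderiv_hamVectorField_comp (hzw ▸ hH), ← hzw] at hid
  exact hid ▸ (he.contDiff_symm.differentiable one_ne_zero (z t)).hasFDerivAt.comp_hasDerivWithinAt
    t hz

end IsGlobalCanonical

/-- Orbits of `H` starting in the ball of radius `ε` stay in the ball of radius `C ε` for times up
to `ε ^ (1 - N) / C`, and drift away from their torus of constant normalized actions `I_j ∘ e⁻¹`
at speed at most `C ε ^ N`. The equation is required only in the ball of radius `C ε`, so that the
notion applies to solutions of a system modified far from the origin. -/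
def ConfinesOrbits (H : Phase n → ℝ) (e : Phase n ≃ₜ Phase n) (N : ℕ) (C ε : ℝ) : Prop :=
  ∀ (z : ℝ → Phase n) (t : ℝ), ContinuousOn z (Set.uIcc 0 t) → ‖z 0‖ ≤ ε →
    (∀ s ∈ Set.uIcc 0 t, ‖z s‖ ≤ C * ε →
      HasDerivWithinAt z (hamVectorField H (z s)) (Set.uIcc 0 t) s) →
    C * ε ^ N * |t| ≤ ε →
    ‖z t‖ ≤ C * ε ∧ ∃ x ∈ actionTorus (fun j => action j (e.symm (z 0))),
      ‖z t - e x‖ ≤ C * ε ^ N * |t|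

namespace IsGlobalCanonical

variable {Φ : MvPolynomial (Fin n) ℝ} {N : ℕ} {B C L ε : ℝ}

theorem confinesOrbits (he : IsGlobalCanonical e) (hε : 0 < ε) (hL : 1 ≤ L)
    (hLip : ∀ w w', ‖w‖ ≤ 2 * (L * ε) → ‖w'‖ ≤ 2 * (L * ε) → ‖e w - e w'‖ ≤ L * ‖w - w'‖)
    (hLip_symm : ∀ z, ‖z‖ ≤ ε → ‖e.symm z‖ ≤ L * ‖z‖)
    (hH : ∀ w, ‖w‖ ≤ 2 * (L * ε) → DifferentiableAt ℝ H (e w))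
    (hB : ∀ w, ‖w‖ ≤ 2 * (L * ε) → ‖hamVectorField (H ∘ e - actionEval Φ) w‖ ≤ B)
    (hCL : 2 * L ^ 2 ≤ C) (hCB : 2 * L * (n * B) ≤ C * ε ^ N) : ConfinesOrbits H e N C ε := by
  intro z t hzc hz0 hz ht
  have hLε : 0 < L * ε := by positivity
  have hzero : ‖(0 : Phase n)‖ ≤ 2 * (L * ε) := by rw [norm_zero]; positivity
  have hw0 : ‖e.symm (z 0)‖ ≤ L * ε := (hLip_symm _ hz0).trans (by gcongr)
  have hnorm (w : Phase n) (hw : ‖w‖ ≤ 2 * (L * ε)) : ‖e w‖ ≤ C * ε := by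
    have hLw : ‖e w‖ ≤ L * ‖w‖ := by simpa [he.map_zero] using hLip w 0 hw hzero
    calc ‖e w‖ ≤ L * (2 * (L * ε)) := hLw.trans (by gcongr)
      _ = 2 * L ^ 2 * ε := by ring
      _ ≤ C * ε := by gcongr
  have hHe (w : Phase n) (hw : ‖w‖ ≤ 2 * (L * ε)) : DifferentiableAt ℝ (H ∘ e) w :=
    (hH w hw).comp w (he.contDiff.differentiable one_ne_zero w)
  have hw (s : ℝ) (hs : s ∈ Set.uIcc 0 t) (hws : ‖(e.symm ∘ z) s‖ ≤ 2 * (L * ε)) :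
      HasDerivWithinAt (e.symm ∘ z) (hamVectorField (H ∘ e) (e.symm (z s))) (Set.uIcc 0 t) s := by
    have hzs := e.apply_symm_apply (z s)
    exact he.hasDerivWithinAt_symm_comp (hzs ▸ hH _ hws) (hz s hs (hzs ▸ hnorm _ hws))
  have hB0 : 0 ≤ B := (norm_nonneg _).trans (hB 0 hzero)
  have hdrift_le : 2 * (L * (n * B * |t|)) ≤ C * ε ^ N * |t| := by
    calc 2 * (L * (n * B * |t|)) = 2 * L * (n * B) * |t| := by ring
      _ ≤ C * ε ^ N * |t| := by gcongr
  have hdrift_nonneg : 0 ≤ L * (n * B * |t|) := by positivity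
  have hdrift_lt : n * B * |t| < L * ε := by nlinarith
  have hwc : ContinuousOn (e.symm ∘ z) (Set.uIcc 0 t) := e.symm.continuous.comp_continuousOn hzc
  have hwt := (norm_lt_two_mul_of_drift_lt hHe hB hwc hw0 hw hdrift_lt).le
  obtain ⟨x, hx, hxw⟩ := exists_mem_actionTorus_of_drift_lt hHe hB hwc hw0 hw hdrift_lt
  have hzt : e ((e.symm ∘ z) t) = z t := e.apply_symm_apply _
  have hxn : ‖x‖ ≤ 2 * (L * ε) := (norm_eq_of_mem_actionTorus hx).trans_le (hw0.trans (by linarith))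
  refine ⟨hzt ▸ hnorm _ hwt, x, hx, ?_⟩
  calc ‖z t - e x‖ ≤ L * ‖(e.symm ∘ z) t - x‖ := hzt ▸ hLip _ _ hwt hxn
    _ ≤ L * (n * B * |t|) := by gcongr
    _ ≤ C * ε ^ N * |t| := by linarith

theorem exists_norm_sub_le (he : IsGlobalCanonical e) :
    ∃ L : ℝ, 1 ≤ L ∧ ∀ᶠ δ in 𝓝[>] 0,
      (∀ w w', ‖w‖ ≤ δ → ‖w'‖ ≤ δ → ‖e w - e w'‖ ≤ L * ‖w - w'‖) ∧
      ∀ z, ‖z‖ ≤ δ → ‖e.symm z‖ ≤ L * ‖z‖ := by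
  obtain ⟨L₁, s₁, hs₁, hL₁⟩ := (he.contDiff (k := 1)).contDiffAt.exists_lipschitzOnWith (x := 0)
  obtain ⟨L₂, s₂, hs₂, hL₂⟩ :=
    (he.contDiff_symm (k := 1)).contDiffAt.exists_lipschitzOnWith (x := 0)
  refine ⟨max 1 (max L₁ L₂), le_max_left _ _, ?_⟩
  filter_upwards [eventually_forall_norm_le hs₁, eventually_forall_norm_le hs₂] with δ h₁ h₂
  refine ⟨fun w w' hw hw' => ?_, fun z hz => ?_⟩
  · refine (hL₁.norm_sub_le (h₁ w hw) (h₁ w' hw')).trans ?_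
    gcongr
    exact (le_max_left _ _).trans (le_max_right _ _)
  · have hsymm : ‖e.symm z‖ ≤ L₂ * ‖z‖ := by
      simpa [e.symm_apply_eq.2 he.map_zero.symm] using
        hL₂.norm_sub_le (h₂ z hz) (mem_of_mem_nhds hs₂)
    refine hsymm.trans ?_
    gcongr
    exact (le_max_right _ _).trans (le_max_right _ _)

theorem exists_norm_hamVectorField_sub_le (he : IsGlobalCanonical e)
    (hH : ContDiffAt ℝ (N + 1) H 0)
    (hO : (H ∘ e - actionEval Φ) =O[𝓝 0] fun z => ‖z‖ ^ (N + 1)) :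
    ∃ K : ℝ, 0 < K ∧ ∀ᶠ δ in 𝓝[>] 0, ∀ w, ‖w‖ ≤ δ →
      DifferentiableAt ℝ H (e w) ∧ ‖hamVectorField (H ∘ e - actionEval Φ) w‖ ≤ K * δ ^ N := by
  have hdiff : ∀ᶠ w in 𝓝 (0 : Phase n), DifferentiableAt ℝ H (e w) :=
    he.tendsto_zero.eventually (((hH.of_le (m := 1) (by simp)).eventually (by simp)).mono
      fun z hz => hz.differentiableAt one_ne_zero)
  obtain ⟨K, hK, hKO⟩ := ((hamVector.isBigO_comp _ _).trans (fderiv_isBigO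
    ((he.contDiffAt_comp hH).sub (contDiff_actionEval Φ).contDiffAt) hO)).exists_pos
  refine ⟨K, hK, ?_⟩
  filter_upwards [eventually_forall_norm_le (hdiff.and hKO.bound)] with δ hδ w hw
  refine ⟨(hδ w hw).1, (hδ w hw).2.trans ?_⟩
  rw [norm_pow, norm_norm]
  gcongr

theorem exists_confinesOrbits (he : IsGlobalCanonical e) (hH : ContDiffAt ℝ (N + 1) H 0)
    (hO : (H ∘ e - actionEval Φ) =O[𝓝 0] fun z => ‖z‖ ^ (N + 1)) :
    ∃ C, 0 < C ∧ ∀ᶠ ε in 𝓝[>] 0, ConfinesOrbits H e N C ε := by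
  obtain ⟨L, hL, hLip⟩ := he.exists_norm_sub_le
  obtain ⟨K, hK, hfield⟩ := he.exists_norm_hamVectorField_sub_le hH hO
  have hL0 : 0 < L := one_pos.trans_le hL
  have hpos : 0 ≤ 2 * L * (n * (K * (2 * L) ^ N)) := by positivity
  refine ⟨2 * L ^ 2 + 2 * L * (n * (K * (2 * L) ^ N)), by positivity, ?_⟩
  filter_upwards [eventually_nhdsGT_zero_mul_left hL0 (eventually_nhdsGT_zero_mul_left two_pos
    (hLip.and hfield)), hLip, eventually_mem_nhdsWithin] with ε ⟨hLip', hfield'⟩ hLip (hε : 0 < ε)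
  refine he.confinesOrbits hε hL hLip'.1 hLip.2 (fun w hw => (hfield' w hw).1)
    (fun w hw => (hfield' w hw).2) (le_add_of_nonneg_right hpos) ?_
  calc _ = 2 * L * (n * (K * (2 * L) ^ N)) * ε ^ N := by
        rw [← mul_assoc 2 L ε, mul_pow]
        ring
    _ ≤ _ := by
        gcongr
        exact le_add_of_nonneg_left (by positivity)

end IsGlobalCanonical

end Transport

section Existence

variable {E : Type*} [NormedAddCommGroup E] [NormedSpace ℝ E]

theorem exists_hasDerivWithinAt_of_lipschitzWith_of_bounded [CompleteSpace E] {X : E → E}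
    {K B : NNReal} (hK : LipschitzWith K X) (hB : ∀ x, ‖X x‖ ≤ B) (x₀ : E) {T : ℝ} (hT : 0 ≤ T) :
    ∃ z : ℝ → E, z 0 = x₀ ∧
      ∀ t ∈ Set.Icc (-T) T, HasDerivWithinAt z (X (z t)) (Set.Icc (-T) T) t := by
  have hpl : IsPicardLindelof (fun _ => X) (tmin := -T) (tmax := T) ⟨0, by simpa using hT⟩ x₀
      (B * T.toNNReal) 0 B K :=
    { lipschitzOnWith := fun t _ => hK.lipschitzOnWith
      continuousOn := fun x _ => continuousOn_const
      norm_le := fun t _ x _ => hB x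
      mul_max_le := by simp [Real.coe_toNNReal _ hT] }
  exact hpl.exists_eq_forall_mem_Icc_hasDerivWithinAt (Metric.mem_closedBall_self le_rfl)

theorem exists_contDiff_hasCompactSupport_eventuallyEq [FiniteDimensional ℝ E]
    {F : Type*} [NormedAddCommGroup F] [NormedSpace ℝ F] {X : E → F} {c : E} {k : ℕ}
    (hX : ContDiffAt ℝ k X c) :
    ∃ Y : E → F, ContDiff ℝ k Y ∧ HasCompactSupport Y ∧ Y =ᶠ[𝓝 c] X := by
  obtain ⟨δ, hδ, hball⟩ := Metric.eventually_nhds_iff_ball.1 (hX.eventually (by simp))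
  let χ : ContDiffBump c := ⟨δ / 4, δ / 2, by positivity, by linarith⟩
  refine ⟨fun x => χ x • X x, contDiff_iff_contDiffAt.2 fun x => ?_,
    χ.hasCompactSupport.smul_right, ?_⟩
  · by_cases hx : x ∈ tsupport χ
    · refine χ.contDiff.contDiffAt.smul (hball x ?_)
      rw [χ.tsupport_eq] at hx
      exact Metric.closedBall_subset_ball (show δ / 2 < δ by linarith) hx
    · refine (contDiffAt_const (c := (0 : F))).congr_of_eventuallyEq ?_
      filter_upwards [notMem_tsupport_iff_eventuallyEq.1 hx] with y hy
      simp [hy]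
  · filter_upwards [χ.eventuallyEq_one] with x hx
    simp [hx]

theorem exists_forall_exists_hasDerivWithinAt [FiniteDimensional ℝ E]
    {X : E → E} {c : E} (hX : ContDiffAt ℝ 1 X c) :
    ∃ s ∈ 𝓝 c, ∀ (x₀ : E) (T : ℝ), 0 ≤ T →
      ∃ z : ℝ → E, z 0 = x₀ ∧ ContinuousOn z (Set.Icc (-T) T) ∧
        ∀ t ∈ Set.Icc (-T) T, z t ∈ s → HasDerivWithinAt z (X (z t)) (Set.Icc (-T) T) t := by
  have := FiniteDimensional.complete ℝ E
  obtain ⟨Y, hY, hYc, hYX⟩ := exists_contDiff_hasCompactSupport_eventuallyEq (k := 1) hX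
  obtain ⟨K, hK⟩ := hY.lipschitzWith_of_hasCompactSupport hYc one_ne_zero
  obtain ⟨B, hB⟩ := hYc.exists_bound_of_continuous hY.continuous
  lift B to NNReal using (norm_nonneg _).trans (hB 0)
  refine ⟨{x | Y x = X x}, hYX, fun x₀ T hT => ?_⟩
  obtain ⟨z, hz0, hz⟩ := exists_hasDerivWithinAt_of_lipschitzWith_of_bounded hK hB x₀ hT
  refine ⟨z, hz0, fun t ht => (hz t ht).continuousWithinAt, fun t ht hzt => ?_⟩
  exact (show Y (z t) = X (z t) from hzt) ▸ hz t ht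

end Existence

section HamiltonianFlow

variable {n : ℕ} {H : Phase n → ℝ}

theorem contDiffAt_hamVectorField {z : Phase n} {k l : WithTop ℕ∞} (hH : ContDiffAt ℝ l H z)
    (hkl : k + 1 ≤ l) : ContDiffAt ℝ k (hamVectorField H) z :=
  hamVector.contDiff.contDiffAt.comp z (hH.fderiv_right hkl)

end HamiltonianFlow

section Normalizing

variable {n : ℕ} {M : Set (Phase n)}

/-- The restriction of a global homeomorphism to the points of `M` that are mapped into `M`. -/
noncomputable def restrictTo (e : Phase n ≃ₜ Phase n) (hM : IsOpen M) :
    OpenPartialHomeomorph (Phase n) (Phase n) :=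
  e.toOpenPartialHomeomorph.restrOpen (M ∩ e ⁻¹' M) (hM.inter (hM.preimage e.continuous))

theorem mem_restrictTo_source (e : Phase n ≃ₜ Phase n) (hM : IsOpen M) {z : Phase n} :
    z ∈ (restrictTo e hM).source ↔ z ∈ M ∧ e z ∈ M := by
  simp [restrictTo]

theorem mem_restrictTo_target (e : Phase n ≃ₜ Phase n) (hM : IsOpen M) {z : Phase n} :
    z ∈ (restrictTo e hM).target ↔ e.symm z ∈ M ∧ z ∈ M := by
  simp [restrictTo]

variable {e : Phase n ≃ₜ Phase n}

theorem IsGlobalCanonical.isAnalyticCanonical_restrictTo (he : IsGlobalCanonical e)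
    (hM : IsOpen M) : IsAnalyticCanonical (restrictTo e hM) where
  analytic := he.analytic.mono (Set.subset_univ _)
  analytic_symm := he.analytic_symm.mono (Set.subset_univ _)
  bracket F G hF hG z hz := by
    have hmem := (restrictTo e hM).open_target.mem_nhds ((restrictTo e hM).map_source hz)
    have hFd : DifferentiableAt ℝ F (e z) := (hF.contDiffAt hmem).differentiableAt (by simp)
    have hGd : DifferentiableAt ℝ G (e z) := (hG.contDiffAt hmem).differentiableAt (by simp)
    have hed : DifferentiableAt ℝ e z := he.contDiff.differentiable one_ne_zero z
    change poissonBracket (F ∘ e) (G ∘ e) z = poissonBracket F G (e z)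
    rw [poissonBracket_eq, poissonBracket_eq, fderiv_comp z hFd hed,
      ContinuousLinearMap.comp_apply, he.fderiv_hamVectorField_comp hGd]

theorem IsGlobalCanonical.isNormalizing_restrictTo (he : IsGlobalCanonical e) (hM : IsOpen M)
    (h0 : 0 ∈ M) {ω : Fin n → ℝ} {P : Phase n → ℝ} {Z : MvPolynomial (Fin n) ℝ} {r N : ℕ}
    (hrN : r ≤ N) (hZ : ((harmonic ω + P) ∘ e - (harmonic ω + actionEval Z))
      =O[𝓝 0] fun z => ‖z‖ ^ (N + 1)) : IsNormalizing M ω P r (restrictTo e hM) where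
  zero_mem_source := by simp [mem_restrictTo_source, he.map_zero, h0]
  zero_mem_target := by
    simp [mem_restrictTo_target, e.symm_apply_eq.2 he.map_zero.symm, h0]
  source_subset z hz := ((mem_restrictTo_source e hM).1 hz).1
  target_subset z hz := ((mem_restrictTo_target e hM).1 hz).2
  canonical := he.isAnalyticCanonical_restrictTo hM
  near_id := he.near_id
  normal_form := by
    obtain ⟨Z', hdeg, hZ'⟩ := exists_totalDegree_le_actionEval_sub_isBigO Z r
    have hZr := hZ.trans (isBigO_norm_pow_of_le (Nat.add_le_add_right hrN 1))
    refine ⟨Z', hdeg, (hZr.add hZ').congr_left fun z => ?_⟩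
    simp only [Pi.add_apply, Pi.sub_apply, Function.comp_apply, actionEval]
    change _ = harmonic ω (e z) + P (e z) - _
    ring

end Normalizing

section NormalizedTorus

variable {n : ℕ}

theorem eventually_actionTorus_subset_source {τ : OpenPartialHomeomorph (Phase n) (Phase n)}
    (h0 : 0 ∈ τ.source) (hτ0 : τ 0 = 0) : ∀ᶠ z in 𝓝 0, z ∈ τ.target ∧
      actionTorus (fun j => action j (τ.symm z)) ⊆ τ.source := by
  have h0t : 0 ∈ τ.target := hτ0 ▸ τ.map_source h0
  obtain ⟨δ, hδ, hball⟩ := Metric.isOpen_iff.1 τ.open_source 0 h0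
  have hsymm : Tendsto τ.symm (𝓝 0) (𝓝 0) := by
    have h := τ.tendsto_symm h0
    rwa [hτ0] at h
  filter_upwards [τ.open_target.mem_nhds h0t, hsymm (Metric.ball_mem_nhds 0 hδ)] with z hz hzδ
  refine ⟨hz, fun x hx => hball ?_⟩
  rw [mem_ball_zero_iff, norm_eq_of_mem_actionTorus hx]
  exact mem_ball_zero_iff.1 hzδ

theorem apply_mem_normalizedTorus {τ : OpenPartialHomeomorph (Phase n) (Phase n)}
    {z₀ x : Phase n} (hsub : actionTorus (fun j => action j (τ.symm z₀)) ⊆ τ.source)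
    (hx : x ∈ actionTorus (fun j => action j (τ.symm z₀))) : τ x ∈ normalizedTorus τ z₀ :=
  ⟨τ.map_source (hsub hx), fun j => by rw [τ.left_inv (hsub hx), hx j]⟩

end NormalizedTorus

section Confined

variable {n N : ℕ} {M : Set (Phase n)} {H : Phase n → ℝ} {e : Phase n ≃ₜ Phase n} {C ε : ℝ}

theorem ConfinesOrbits.isSolutionOn (hconf : ConfinesOrbits H e N C ε) (hC : 0 ≤ C) (hε : 0 ≤ ε)
    (hCM : ∀ x, ‖x‖ ≤ C * ε → x ∈ M) {z : ℝ → Phase n} {T : ℝ}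
    (hzc : ContinuousOn z (Set.Icc (-T) T)) (hz0 : ‖z 0‖ ≤ ε)
    (hz : ∀ t ∈ Set.Icc (-T) T, ‖z t‖ ≤ C * ε →
      HasDerivWithinAt z (hamVectorField H (z t)) (Set.Icc (-T) T) t)
    (hT : C * ε ^ N * T ≤ ε) : IsSolutionOn M H (Set.Icc (-T) T) z := by
  intro t ht
  have htT : |t| ≤ T := abs_le.2 ht
  have hsub : Set.uIcc 0 t ⊆ Set.Icc (-T) T :=
    Set.ordConnected_Icc.uIcc_subset
      (Set.mem_Icc.2 (abs_le.1 (abs_zero.trans_le ((abs_nonneg t).trans htT)))) ht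
  have hzt : ‖z t‖ ≤ C * ε :=
    (hconf z t (hzc.mono hsub) hz0 (fun s hs hzs => (hz s (hsub hs) hzs).mono hsub)
      ((mul_le_mul_of_nonneg_left htT (by positivity)).trans hT)).1
  exact ⟨hCM _ hzt, hz t ht hzt⟩

theorem eventually_exists_isSolutionOn (hM : M ∈ 𝓝 0) (hH : ContDiffAt ℝ 2 H 0) (hC : 0 < C)
    (hconf : ∀ᶠ ε in 𝓝[>] 0, ConfinesOrbits H e N C ε) :
    ∀ᶠ ε in 𝓝[>] 0, ∀ z₀ : Phase n, ‖z₀‖ ≤ ε → ∀ T, 0 ≤ T →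
      C * ε ^ N * T ≤ ε → ∃ z : ℝ → Phase n, z 0 = z₀ ∧ IsSolutionOn M H (Set.Icc (-T) T) z := by
  obtain ⟨s, hs, hflow⟩ := exists_forall_exists_hasDerivWithinAt
    (contDiffAt_hamVectorField (k := 1) hH (by norm_num))
  filter_upwards [hconf, eventually_mem_nhdsWithin,
    eventually_nhdsGT_zero_mul_left hC (eventually_forall_norm_le (inter_mem hs hM))]
    with ε hconf (hε : 0 < ε) hsM z₀ hz₀ T hT hCT
  obtain ⟨z, rfl, hzc, hz⟩ := hflow z₀ T hT
  exact ⟨z, rfl, hconf.isSolutionOn hC.le hε.le (fun x hx => (hsM x hx).2) hzc hz₀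
    (fun t ht hzt => hz t ht (hsM _ hzt).1) hCT⟩

theorem ConfinesOrbits.infDist_normalizedTorus_le (hconf : ConfinesOrbits H e N C ε)
    (hC : 0 ≤ C) (hε : 0 ≤ ε) (hM : IsOpen M) {J : Set ℝ} {z : ℝ → Phase n} {t T : ℝ}
    (hsub : actionTorus (fun j => action j (e.symm (z 0))) ⊆ (restrictTo e hM).source)
    (hJ : J.OrdConnected) (h0 : 0 ∈ J) (hz : IsSolutionOn M H J z) (hz0 : ‖z 0‖ ≤ ε)
    (ht : t ∈ J) (htT : |t| ≤ T) (hT : C * ε ^ N * T ≤ ε) :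
    Metric.infDist (z t) (normalizedTorus (restrictTo e hM) (z 0)) ≤ C * ε ^ N * T := by
  have hJt : Set.uIcc 0 t ⊆ J := hJ.uIcc_subset h0 ht
  have htT' : C * ε ^ N * |t| ≤ C * ε ^ N * T := by gcongr
  obtain ⟨-, x, hx, hxz⟩ := hconf z t
    (fun s hs => (hz s (hJt hs)).2.continuousWithinAt.mono hJt) hz0
    (fun s hs _ => (hz s (hJt hs)).2.mono hJt) (htT'.trans hT)
  have hmem : e x ∈ normalizedTorus (restrictTo e hM) (z 0) :=
    apply_mem_normalizedTorus (τ := restrictTo e hM) hsub hx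
  calc _ ≤ dist (z t) (e x) := Metric.infDist_le_dist_of_mem hmem
    _ ≤ C * ε ^ N * T := (dist_eq_norm _ _).trans_le (hxz.trans htT')

end Confined

section Scale

theorem eventually_le_one_and_mul_le_one {C : ℝ} (hC : 0 < C) :
    ∀ᶠ ε in 𝓝[>] (0 : ℝ), ε ≤ 1 ∧ C * ε ≤ 1 :=
  have hone : ∀ᶠ ε in 𝓝[>] (0 : ℝ), ε ≤ 1 :=
    mem_of_superset (Ioc_mem_nhdsGT one_pos) fun _ h => h.2
  hone.and (eventually_nhdsGT_zero_mul_left hC hone)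

theorem one_div_zero_rpow_le_one (x : ℝ) : 1 / (0 : ℝ) ^ x ≤ 1 := by
  rcases eq_or_ne x 0 with rfl | hx
  · simp
  · simp [Real.zero_rpow hx]

theorem pow_add_three_mul_one_div_rpow {ρ r₁ r₂ : ℝ} {r : ℕ} (hρ : 0 < ρ) (hr : r₁ + r₂ = r + 1) :
    ρ ^ (r + 3) * (1 / ρ ^ r₂) = ρ ^ 2 * ρ ^ r₁ := by
  rw [mul_one_div, div_eq_iff (by positivity), mul_assoc, ← Real.rpow_add hρ, hr]
  norm_cast
  ring

/-- At `ρ = 0` the time `1 / ρ ^ r₂` is a junk value in `[0, 1]` and no scale `ε ≥ ρ` is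
distinguished: an arbitrarily small one is taken, whence the slack `η`. -/
theorem exists_scale {C ε₀ ρ r₁ r₂ η : ℝ} {r : ℕ} (hC : 0 < C)
    (hε₀ : ∀ ε ∈ Set.Ioo 0 ε₀, ε ≤ 1 ∧ C * ε ≤ 1) (hρ : 0 ≤ ρ) (hρε₀ : ρ < ε₀) (hr₁ : 0 ≤ r₁)
    (hr : r₁ + r₂ = r + 1) (hη : 0 < η) :
    ∃ ε ∈ Set.Ioo 0 ε₀, ρ ≤ ε ∧ C * ε ^ (r + 3) * (1 / ρ ^ r₂) ≤ ε ∧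
      C * ε ^ (r + 3) * (1 / ρ ^ r₂) ≤ C * ρ ^ r₁ + η := by
  rcases hρ.eq_or_lt with rfl | hρ
  · obtain ⟨ε, hε, hεη⟩ : ∃ ε ∈ Set.Ioo 0 ε₀, ε ≤ η := by
      obtain ⟨ε, hε, hlt⟩ := exists_between (lt_min hρε₀ hη)
      exact ⟨ε, ⟨hε, hlt.trans_le (min_le_left _ _)⟩, hlt.le.trans (min_le_right _ _)⟩
    obtain ⟨hε1, hCε⟩ := hε₀ ε hε
    have hε0 : 0 < ε := hε.1
    have hle : C * ε ^ (r + 3) * (1 / (0 : ℝ) ^ r₂) ≤ ε :=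
      calc _ ≤ C * ε ^ (r + 3) * 1 := by gcongr; exact one_div_zero_rpow_le_one r₂
        _ = C * ε * ε * ε ^ (r + 1) := by ring
        _ ≤ 1 * ε * 1 := by gcongr; exact pow_le_one₀ hε0.le hε1
        _ = ε := by ring
    exact ⟨ε, hε, hε0.le, hle, (hle.trans hεη).trans (le_add_of_nonneg_left (by positivity))⟩
  · obtain ⟨hρ1, hCρ⟩ := hε₀ ρ ⟨hρ, hρε₀⟩
    have hpow : ρ ^ r₁ ≤ 1 := Real.rpow_le_one hρ.le hρ1 hr₁
    refine ⟨ρ, ⟨hρ, hρε₀⟩, le_rfl, ?_, ?_⟩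
    · calc _ = C * ρ * ρ * ρ ^ r₁ := by
            rw [mul_assoc, pow_add_three_mul_one_div_rpow hρ hr]; ring
        _ ≤ 1 * ρ * 1 := by gcongr
        _ = ρ := by ring
    · calc _ = C * ρ ^ r₁ * ρ ^ 2 := by
            rw [mul_assoc, pow_add_three_mul_one_div_rpow hρ hr]; ring
        _ ≤ C * ρ ^ r₁ * 1 := by gcongr; exact pow_le_one₀ hρ.le hρ1
        _ ≤ C * ρ ^ r₁ + η := by linarith

end Scale

end Birkhoff

open Birkhoff Asymptotics Filter

theorem mainTheorem8_general {n : ℕ} (M : Set (Phase n)) (hM : IsOpen M) (h0 : 0 ∈ M)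
    (ω : Fin n → ℝ) (r : ℕ) (hω : NonResonantUpTo (r + 3) ω) (P : Phase n → ℝ)
    (hP : ContDiffAt ℝ (r + 4) P 0) (hP3 : P =O[𝓝 0] fun z => ‖z‖ ^ 3) :
    ∃ τ : OpenPartialHomeomorph (Phase n) (Phase n), IsNormalizing M ω P r τ ∧
      ∃ ε₀ : ℝ, 0 < ε₀ ∧ ∃ C : ℝ, 0 < C ∧ ∀ z₀ : Phase n, ‖z₀‖ < ε₀ →
        z₀ ∈ τ.target ∧ actionTorus (fun j => action j (τ.symm z₀)) ⊆ τ.source ∧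
        ∀ r₁ r₂ : ℝ, 0 ≤ r₁ → r₁ + r₂ = r + 1 →
          (∃ z : ℝ → Phase n, z 0 = z₀ ∧
            IsSolutionOn M (harmonic ω + P) (Set.Icc (-(1 / ‖z₀‖ ^ r₂)) (1 / ‖z₀‖ ^ r₂)) z) ∧
          ∀ (J : Set ℝ) (z : ℝ → Phase n), J.OrdConnected → 0 ∈ J → z 0 = z₀ →
            IsSolutionOn M (harmonic ω + P) J z → ∀ t ∈ J, |t| ≤ 1 / ‖z₀‖ ^ r₂ →
              Metric.infDist (z t) (normalizedTorus τ z₀) ≤ C * ‖z₀‖ ^ r₁ := by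
  have hH : ContDiffAt ℝ ((r + 3 : ℕ) + 1) (harmonic ω + P) 0 :=
    (contDiff_harmonic ω).contDiffAt.add (by convert hP using 1; push_cast; ring)
  obtain ⟨e, he, -, Z, hZ⟩ := exists_isGlobalCanonical_comp_sub_actionEval_isBigO
    (Nat.le_add_left 2 (r + 1)) hω hH (by simpa using hP3)
  have hnormal := he.isNormalizing_restrictTo hM h0 (Nat.le_add_right r 3) hZ
  obtain ⟨Φ, hΦ⟩ := exists_actionEval_eq_harmonic_add ω Z
  obtain ⟨C, hC, hconf⟩ := he.exists_confinesOrbits hH (hΦ ▸ hZ)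
  have hexists := eventually_exists_isSolutionOn (hM.mem_nhds h0)
    (hH.of_le (by norm_cast; omega)) hC hconf
  have htorus := eventually_actionTorus_subset_source hnormal.zero_mem_source he.map_zero
  have hsmall := eventually_le_one_and_mul_le_one hC
  obtain ⟨ε₀, hε₀, hgood⟩ := mem_nhdsGT_iff_exists_Ioo_subset.1
    (hconf.and (hexists.and ((eventually_forall_norm_le htorus).and hsmall)))
  have hbound : ∀ ε ∈ Set.Ioo 0 ε₀, ε ≤ 1 ∧ C * ε ≤ 1 := fun ε hε => (hgood hε).2.2.2
  refine ⟨restrictTo e hM, hnormal, ε₀, hε₀, C, hC, fun z₀ hz₀ => ?_⟩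
  obtain ⟨ε, hzε, hεε₀⟩ := exists_between hz₀
  obtain ⟨hmem, hsub⟩ := (hgood ⟨(norm_nonneg _).trans_lt hzε, hεε₀⟩).2.2.1 z₀ hzε.le
  refine ⟨hmem, hsub, fun r₁ r₂ hr₁ hr => ⟨?_, fun J z hJ h0J hz0 hz t htJ ht => ?_⟩⟩
  · obtain ⟨ε, hε, hle, hT, -⟩ :=
      exists_scale hC hbound (norm_nonneg z₀) hz₀ hr₁ hr one_pos
    exact (hgood hε).2.1 z₀ hle _ (by positivity) hT
  · refine le_of_forall_pos_le_add fun η hη => ?_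
    obtain ⟨ε, hε, hle, hT, hdist⟩ :=
      exists_scale hC hbound (norm_nonneg z₀) hz₀ hr₁ hr hη
    subst hz0
    exact ((hgood hε).1.infDist_normalizedTorus_le hC.le hε.1.le hM hsub hJ h0J hz hle htJ ht
      hT).trans hdist

theorem mainTheorem8 {n : ℕ} (M : Set (Birkhoff.Phase n)) (hM : IsOpen M) (h0 : 0 ∈ M)
    (ω : Fin n → ℝ) (hω : Birkhoff.NonResonant ω)
    (P : Birkhoff.Phase n → ℝ) (hP : ContDiffOn ℝ (⊤ : ℕ∞) P M)
    (hP3 : P =O[𝓝 0] fun z => ‖z‖ ^ 3)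
    (r : ℕ) (hr : 3 ≤ r) :
    ∃ τ : OpenPartialHomeomorph (Birkhoff.Phase n) (Birkhoff.Phase n),
      Birkhoff.IsNormalizing M ω P r τ ∧
      ∃ ε₀ : ℝ, 0 < ε₀ ∧ ∃ C : ℝ, 0 < C ∧
        ∀ z₀ : Birkhoff.Phase n, ‖z₀‖ < ε₀ →
          z₀ ∈ τ.target ∧
          Birkhoff.actionTorus (fun j => Birkhoff.action j (τ.symm z₀)) ⊆ τ.source ∧
          ∀ r₁ r₂ : ℝ, 0 ≤ r₁ → r₁ + r₂ = r + 1 →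
            (∃ z : ℝ → Birkhoff.Phase n, z 0 = z₀ ∧
              Birkhoff.IsSolutionOn M (Birkhoff.harmonic ω + P)
                (Set.Icc (-(1 / ‖z₀‖ ^ r₂)) (1 / ‖z₀‖ ^ r₂)) z) ∧
            ∀ (J : Set ℝ) (z : ℝ → Birkhoff.Phase n), J.OrdConnected → 0 ∈ J → z 0 = z₀ →
              Birkhoff.IsSolutionOn M (Birkhoff.harmonic ω + P) J z →
              ∀ t ∈ J, |t| ≤ 1 / ‖z₀‖ ^ r₂ →
                Metric.infDist (z t) (Birkhoff.normalizedTorus τ z₀) ≤ C * ‖z₀‖ ^ r₁ :=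
  mainTheorem8_general M hM h0 ω r (hω.nonResonantUpTo _) P
    ((hP.contDiffAt (hM.mem_nhds h0)).of_le (WithTop.coe_le_coe.2 le_top)) hP3
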